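/- **Lemma 11.** Let $X$ be a complex manifold with holomorphic Poisson structure $\Lambda$, that is, a bivector field $\Lambda \in C^\infty(X, \wedge^2 T^{1,0})$ with $\bar\partial \Lambda = 0$ and $[\Lambda, \Lambda] = 0$ (Schouten bracket). Let $A^{p,q} = C^\infty(X, \wedge^p T^{1,0} \otimes \wedge^q T^{*(0,1)})$, with the double complex structure given by $\bar\partial : A^{p,q} \to A^{p,q+1}$ and $\mathrm{ad}_\Lambda = [\Lambda, \cdot\,] : A^{p,q} \to A^{p+1,q}$. The Poisson spectral sequence $(E_n^{p,q}, d_n^{p,q})$, with $d_n^{p,q} : E_n^{p,q} \to E_n^{p+n,q-n+1}$, is the spectral sequence of the total complex $K^m = \bigoplus_{p+q=m} A^{p,q}$, with differential $\bar\partial_\Lambda = \bar\partial + \mathrm{ad}_\Lambda$, filtered by $F^pK^m = \bigoplus_{p' \ge p,\ p'+q=m} A^{p',q}$. The Frölicher spectral sequence of $X$ is the spectral sequence of the complex of smooth complex valued differential forms with $d = \partial + \bar\partial$, filtered by $F^p\Omega^m = \bigoplus_{p'\ge p,\ p'+q=m} \Omega^{p',q}$. Suppose that the Frölicher spectral sequence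 of $X$ degenerates at $E_1$, i.e. that all its differentials $d_r^{p,q}$ with $r \ge 1$ vanish. Then, in the Poisson spectral sequence, $$E_n^{0,q} = E_1^{0,q} = H^q(X, \mathcal O) \quad\text{and}\quad d_n^{0,q} = 0 \qquad \text{for all } q \ge 0 \text{ and all } n \ge 2.$$ Here $H^q(X,\mathcal O)$ is the Dolbeault cohomology, the space of $\bar\partial$-closed $(0,q)$-forms modulo $\bar\partial$-exact ones. The first equality means that the classes in $E_n^{0,q}$ and $E_1^{0,q}$ of the same elements of $F^0K^q$ correspond under an isomorphism $E_n^{0,q} \cong E_1^{0,q}$; the second, that the class in $E_1^{0,q}$ of an element corresponds to the class of its $(0,q)$-component under an isomorphism $E_1^{0,q} \cong H^q(X,\mathcal O)$. -/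

import Mathlib

/-!
Complex vector fields, differential forms and polyvector fields on a complex manifold `X` are
described over the algebra `A` of smooth complex valued functions: complex vector fields are the
derivations of `A`, and tensor fields are `A`-multilinear maps on modules of fields.
The first part is algebra over an arbitrary commutative `ℂ`-algebra `A` with a splitting of its
derivations into types `(1,0)` and `(0,1)`; the last part constructs this splitting for the
algebra of smooth functions of a complex manifold.
-/

set_option linter.unusedSectionVars false

open Function

/-- The data of a Lie algebroid, on the level of sections: a module `M` over a function algebra `A`
with an anchor to the derivations of `A` and an alternating bracket which satisfies the Leibniz
rule. The Jacobi identity is not part of the data. -/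
structure AlmostLieAlgebroid (A M : Type*) [CommRing A] [Algebra ℂ A] [AddCommGroup M] [Module A M]
    [Module ℂ M] where
  anchor : M →ₗ[A] Derivation ℂ A A
  bracket : M →ₗ[ℂ] M →ₗ[ℂ] M
  bracket_self : ∀ v, bracket v v = 0
  bracket_smul : ∀ (v w : M) (f : A), bracket v (f • w) = f • bracket v w + anchor v f • w

namespace AlmostLieAlgebroid

variable {A M : Type*} [CommRing A] [Algebra ℂ A] [AddCommGroup M] [Module A M]
    [Module ℂ M] (S : AlmostLieAlgebroid A M) {n : ℕ}

theorem bracket_skew (v w : M) : S.bracket v w = - S.bracket w v := by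
  have h := S.bracket_self (v + w)
  simp only [map_add, LinearMap.add_apply, S.bracket_self, zero_add, add_zero] at h
  exact eq_neg_of_add_eq_zero_right h

theorem smul_bracket (v w : M) (f : A) :
    S.bracket (f • v) w = f • S.bracket v w - S.anchor w f • v := by
  rw [S.bracket_skew, S.bracket_smul, S.bracket_skew w v, smul_neg]; abel

/-- The Lie derivative of an alternating form along a derivation `D` of `A` and a compatible
derivation `L` of `M`:  `(L P)(w₁, …, wₙ) = D (P (w₁, …, wₙ)) - ∑ P (w₁, …, L wᵢ, …, wₙ)`. -/
def derAlt (D : Derivation ℂ A A) (L : M →ₗ[ℂ] M)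
    (hL : ∀ (w : M) (f : A), L (f • w) = f • L w + D f • w)
    (P : M [⋀^Fin n]→ₗ[A] A) : M [⋀^Fin n]→ₗ[A] A where
  toFun w := D (P w) - ∑ i, P (update w i (L (w i)))
  map_update_add' {inst} w i x y := by
    obtain rfl : inst = instDecidableEqFin n := Subsingleton.elim _ _
    have : ∀ k, P (update (update w i (x + y)) k (L (update w i (x + y) k))) =
        P (update (update w i x) k (L (update w i x k))) +
        P (update (update w i y) k (L (update w i y k))) := by
      intro k
      rcases eq_or_ne k i with rfl | h
      · simp
      · simp [h, update_comm h.symm]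
    simp only [this, Finset.sum_add_distrib, P.map_update_add, map_add]
    abel
  map_update_smul' {inst} w i f x := by
    obtain rfl : inst = instDecidableEqFin n := Subsingleton.elim _ _
    have : ∀ k, P (update (update w i (f • x)) k (L (update w i (f • x) k))) =
        f * P (update (update w i x) k (L (update w i x k))) +
        if k = i then D f * P (update w i x) else 0 := by
      intro k
      rcases eq_or_ne k i with rfl | h
      · simp [hL]
      · simp [h, update_comm h.symm]
    simp only [this, Finset.sum_add_distrib, P.map_update_smul, smul_eq_mul, Derivation.leibniz,
      Finset.sum_ite_eq', Finset.mem_univ, if_true, ← Finset.mul_sum]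
    ring
  map_eq_zero_of_eq' w i j h hij := by
    rw [P.map_eq_zero_of_eq w h hij, map_zero, zero_sub, neg_eq_zero,
      Fintype.sum_eq_add i j hij]
    · have e : update w j (L (w j)) =
          (update w i (L (w i))) ∘ Equiv.swap i j := by
        rw [← h]
        ext k
        rcases eq_or_ne k i with rfl | hk
        · simp [hij, h, hij.symm]
        rcases eq_or_ne k j with rfl | hk'
        · simp
        · simp [hk, hk', Equiv.swap_apply_of_ne_of_ne hk hk']
      rw [e, P.map_swap _ hij]; simp
    · rintro k ⟨hi, hj⟩
      exact P.map_eq_zero_of_eq _ (by simp [hi.symm, hj.symm, h]) hij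

theorem derAlt_cons {D : Derivation ℂ A A} {L : M →ₗ[ℂ] M}
    (hL : ∀ (w : M) (f : A), L (f • w) = f • L w + D f • w) (u : M)
    (P : M [⋀^Fin (n + 1)]→ₗ[A] A) (w : Fin n → M) :
    derAlt D L hL P (Fin.cons u w) =
      derAlt D L hL (P.curryLeft u) w - P.curryLeft (L u) w := by
  change D _ - _ = (D _ - _) - _
  simp only [Fin.sum_univ_succ, Fin.cons_zero, Fin.cons_succ, ← Fin.cons_update,
    Fin.update_cons_zero, AlternatingMap.curryLeft_apply_apply, Matrix.vecCons]
  ring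

/-- The Lie derivative of an alternating form along a section `v`. -/
def lieDer (v : M) (P : M [⋀^Fin n]→ₗ[A] A) : M [⋀^Fin n]→ₗ[A] A :=
  derAlt (S.anchor v) (S.bracket v) (S.bracket_smul v) P

theorem lieDer_apply (v : M) (P : M [⋀^Fin n]→ₗ[A] A) (w : Fin n → M) :
    S.lieDer v P w = S.anchor v (P w) - ∑ i, P (update w i (S.bracket v (w i))) := rfl

/-- The Chevalley--Eilenberg formula:
`∑ᵢ (-1)^i ρ(wᵢ) P(…, ŵᵢ, …) + ∑_{i<j} (-1)^(i+j) P([wᵢ, wⱼ], …, ŵᵢ, …, ŵⱼ, …)`. The bracket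
`[wᵢ, wⱼ]` is written at the place of `wⱼ`, which accounts for the sign `-(-1)^i`. -/
def diffFun (P : M [⋀^Fin n]→ₗ[A] A) (w : Fin (n + 1) → M) : A :=
  ∑ i : Fin (n + 1), (-1) ^ (i : ℕ) * (S.anchor (w i) (P (i.removeNth w)) -
    ∑ j : Fin n, if i < i.succAbove j then
      P (update (i.removeNth w) j (S.bracket (w i) (w (i.succAbove j)))) else 0)

theorem removeNth_succ_cons (v : M) (w : Fin (n + 1) → M) (i : Fin (n + 1)) :
    (i.succ.removeNth (Fin.cons v w : Fin (n + 2) → M)) = Fin.cons v (i.removeNth w) := by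
  ext k; refine Fin.cases ?_ (fun k => ?_) k <;> simp [Fin.removeNth]

theorem diffFun_cons (P : M [⋀^Fin (n + 1)]→ₗ[A] A) (v : M) (w : Fin (n + 1) → M) :
    S.diffFun P (Fin.cons v w) = S.lieDer v P w - S.diffFun (P.curryLeft v) w := by
  rw [diffFun, Fin.sum_univ_succ, lieDer_apply, diffFun, sub_eq_add_neg (_ - _),
    ← Finset.sum_neg_distrib]
  congr 1
  · simp
  · refine Finset.sum_congr rfl fun i _ => ?_
    rw [Fin.sum_univ_succ]
    simp only [removeNth_succ_cons, Fin.cons_succ, Fin.succ_succAbove_zero,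
      Fin.succ_succAbove_succ, Fin.not_lt_zero,
      if_false, zero_add, Fin.succ_lt_succ_iff, Fin.val_succ, ← Fin.cons_update]
    simp only [AlternatingMap.curryLeft_apply_apply, Matrix.vecCons, pow_succ]
    ring

theorem diffFun_cons_zero (P : M [⋀^Fin 0]→ₗ[A] A) (w : Fin 1 → M) :
    S.diffFun P w = S.lieDer (w 0) P Fin.elim0 := by
  simp [diffFun, lieDer_apply]
  congr 2
  exact Subsingleton.elim _ _

theorem lieDer_cons (v u : M) (P : M [⋀^Fin (n + 1)]→ₗ[A] A) (w : Fin n → M) :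
    S.lieDer v P (Fin.cons u w) = S.lieDer v (P.curryLeft u) w - P.curryLeft (S.bracket v u) w :=
  derAlt_cons _ u P w

theorem lieDer_curryLeft (v u : M) (P : M [⋀^Fin (n + 1)]→ₗ[A] A) :
    (S.lieDer v P).curryLeft u = S.lieDer v (P.curryLeft u) - P.curryLeft (S.bracket v u) := by
  ext w
  exact S.lieDer_cons v u P w

theorem lieDer_add (v v' : M) (P : M [⋀^Fin n]→ₗ[A] A) :
    S.lieDer (v + v') P = S.lieDer v P + S.lieDer v' P := by
  ext w
  simp only [lieDer_apply, map_add, LinearMap.add_apply, Derivation.add_apply,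
    AlternatingMap.map_update_add, Finset.sum_add_distrib, AlternatingMap.add_apply]
  ring

theorem map_update_eq (P : M [⋀^Fin (n + 1)]→ₗ[A] A) (w : Fin (n + 1) → M) (i : Fin (n + 1))
    (v : M) : P (update w i v) = (-1) ^ (i : ℕ) * P.curryLeft v (i.removeNth w) := by
  rw [← Fin.insertNth_removeNth, AlternatingMap.map_insertNth]
  rw [AlternatingMap.curryLeft_apply_apply, ← Int.cast_smul_eq_zsmul A]
  simp

theorem lieDer_smul_left (f : A) (v : M) (P : M [⋀^Fin (n + 1)]→ₗ[A] A)
    (w : Fin (n + 1) → M) :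
    S.lieDer (f • v) P w = f * S.lieDer v P w +
      ∑ i : Fin (n + 1), (-1) ^ (i : ℕ) * (S.anchor (w i) f * P.curryLeft v (i.removeNth w)) := by
  simp only [lieDer_apply, map_smul, Derivation.smul_apply, smul_bracket, P.map_update_sub,
    P.map_update_smul, Finset.sum_sub_distrib, smul_eq_mul, ← Finset.mul_sum]
  simp only [map_update_eq P w _ v, mul_left_comm]
  ring

theorem diffFun_add (P Q : M [⋀^Fin n]→ₗ[A] A) (w : Fin (n + 1) → M) :
    S.diffFun (P + Q) w = S.diffFun P w + S.diffFun Q w := by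
  simp only [diffFun, ← Finset.sum_add_distrib]
  refine Finset.sum_congr rfl fun i _ => ?_
  rw [← mul_add, sub_add_sub_comm, ← Finset.sum_add_distrib]
  congr 2
  · simp
  · refine Finset.sum_congr rfl fun j _ => ?_
    split_ifs <;> simp

theorem diffFun_smul (f : A) (P : M [⋀^Fin n]→ₗ[A] A) (w : Fin (n + 1) → M) :
    S.diffFun (f • P) w = f * S.diffFun P w +
      ∑ i : Fin (n + 1), (-1) ^ (i : ℕ) * (S.anchor (w i) f * P (i.removeNth w)) := by
  simp only [diffFun, Finset.mul_sum, ← Finset.sum_add_distrib]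
  refine Finset.sum_congr rfl fun i _ => ?_
  simp only [AlternatingMap.smul_apply, smul_eq_mul, Derivation.leibniz, mul_sub, Finset.mul_sum]
  have : ∀ j, (if i < i.succAbove j then
      f * P (update (i.removeNth w) j (S.bracket (w i) (w (i.succAbove j)))) else 0) =
      f * (if i < i.succAbove j then
      P (update (i.removeNth w) j (S.bracket (w i) (w (i.succAbove j)))) else 0) := by
    intro j; split_ifs <;> simp
  simp only [this, mul_left_comm]
  ring

theorem diffFun_zero (w : Fin (n + 1) → M) :
    S.diffFun (0 : M [⋀^Fin n]→ₗ[A] A) w = 0 := by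
  simpa using S.diffFun_add (0 : M [⋀^Fin n]→ₗ[A] A) 0 w

theorem exists_diff : ∀ {n : ℕ} (P : M [⋀^Fin n]→ₗ[A] A),
    ∃ Q : M [⋀^Fin (n + 1)]→ₗ[A] A, ∀ w, Q w = S.diffFun P w := by
  intro n
  induction n with
  | zero =>
    intro P
    let g : M →ₗ[A] A :=
      { toFun := fun v => S.anchor v (P Fin.elim0)
        map_add' := by simp
        map_smul' := by simp }
    refine ⟨AlternatingMap.ofSubsingleton A M A (0 : Fin 1) g, fun w => ?_⟩
    rw [diffFun_cons_zero, lieDer_apply]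
    simp [g]
  | succ n ih =>
    intro P
    choose D hD using ih
    let G : M →ₗ[A] M [⋀^Fin (n + 1)]→ₗ[A] A :=
      { toFun := fun v => S.lieDer v P - D (P.curryLeft v)
        map_add' := fun v v' => by
          ext w
          simp only [lieDer_add, map_add, AlternatingMap.sub_apply, AlternatingMap.add_apply, hD,
            diffFun_add]
          ring
        map_smul' := fun f v => by
          ext w
          simp only [map_smul, AlternatingMap.sub_apply, AlternatingMap.smul_apply, hD,
            diffFun_smul, lieDer_smul_left, RingHom.id_apply, smul_eq_mul]
          ring }
    have hG : ∀ v w, G v w = S.diffFun P (Fin.cons v w) := fun v w => by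
      rw [diffFun_cons, ← hD]; rfl
    let Q : MultilinearMap A (fun _ : Fin (n + 2) => M) A :=
      LinearMap.uncurryLeft (AlternatingMap.toMultilinearMapLM (S := A) ∘ₗ G)
    have hQ : ∀ w, Q w = S.diffFun P w := fun w => by
      rw [← Fin.cons_self_tail w, ← hG]; simp [Q]
    have hcons : ∀ v w, Q (Fin.cons v w) = G v w := fun v w => by rw [hQ, hG]
    have h2 : ∀ v (u : Fin n → M), Q (Fin.cons v (Fin.cons v u)) = 0 := by
      intro v u
      rw [hQ, diffFun_cons, lieDer_cons, S.bracket_self]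
      cases n with
      | zero =>
        rw [diffFun_cons_zero, Subsingleton.elim u Fin.elim0]
        simp
      | succ n =>
        rw [diffFun_cons]
        simp [diffFun_zero]
    have h3 : ∀ (v v' : M) (u : Fin n → M), Q (Fin.cons v (Fin.cons v' u)) =
        - Q (Fin.cons v' (Fin.cons v u)) := by
      intro v v' u
      have h := h2 (v + v') u
      have e : ∀ x y, Q (Fin.cons x (Fin.cons y u)) = (G x).curryLeft y u := fun x y => hcons _ _
      simp only [e, map_add, AlternatingMap.add_apply, AlternatingMap.curryLeft_add,
        LinearMap.add_apply] at h ⊢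
      simp only [← e, h2] at h ⊢
      linear_combination h
    have h4 : ∀ (v : M) (w : Fin (n + 1) → M) (j : Fin (n + 1)), w j = v →
        Q (Fin.cons v w) = 0 := by
      intro v w j hj
      refine Fin.cases (fun hj => ?_) (fun j hj => ?_) j hj
      · rw [← Fin.cons_self_tail w, hj, h2]
      · rw [← Fin.cons_self_tail w, h3, hcons]
        rw [(G (w 0)).map_eq_zero_of_eq (i := 0) (j := j.succ), neg_zero]
        · simpa [Fin.tail] using hj.symm
        · exact (Fin.succ_ne_zero j).symm
    refine ⟨{ Q with map_eq_zero_of_eq' := ?_ }, hQ⟩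
    intro w i j h hij
    change Q w = 0
    revert h hij
    rw [← Fin.cons_self_tail w]
    generalize w 0 = v
    generalize Fin.tail w = w
    refine Fin.cases ?_ (fun i => ?_) i <;> refine Fin.cases ?_ (fun j => ?_) j
    · simp
    · intro h _; exact h4 _ _ j (by simpa using h.symm)
    · intro h _; exact h4 _ _ i (by simpa using h)
    · intro h hij
      rw [hcons]
      exact (G v).map_eq_zero_of_eq w (by simpa using h) (by simpa using hij)

/-- The Chevalley--Eilenberg differential on alternating forms. -/
def diff (n : ℕ) : (M [⋀^Fin n]→ₗ[A] A) →ₗ[ℂ] (M [⋀^Fin (n + 1)]→ₗ[A] A) where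
  toFun P :=
    { toFun := S.diffFun P
      map_update_add' := by
        obtain ⟨Q, hQ⟩ := S.exists_diff P
        intro _ w i x y
        simp only [← hQ, Q.map_update_add]
      map_update_smul' := by
        obtain ⟨Q, hQ⟩ := S.exists_diff P
        intro _ w i x y
        simp only [← hQ, Q.map_update_smul]
      map_eq_zero_of_eq' := by
        obtain ⟨Q, hQ⟩ := S.exists_diff P
        intro w i j h hij
        simp only [← hQ, Q.map_eq_zero_of_eq w h hij] }
  map_add' P Q := by
    ext w
    exact S.diffFun_add P Q w
  map_smul' c P := by
    ext w
    change S.diffFun (c • P) w = c • S.diffFun P w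
    have : c • P = (algebraMap ℂ A c) • P := by ext; simp [Algebra.smul_def]
    rw [this, diffFun_smul]
    simp [Algebra.smul_def]

theorem diff_apply (P : M [⋀^Fin n]→ₗ[A] A) (w : Fin (n + 1) → M) :
    S.diff n P w = S.diffFun P w := rfl

theorem diff_curryLeft (P : M [⋀^Fin (n + 1)]→ₗ[A] A) (v : M) :
    (S.diff (n + 1) P).curryLeft v = S.lieDer v P - S.diff n (P.curryLeft v) := by
  ext w
  exact S.diffFun_cons P v w

theorem diff_curryLeft_zero (P : M [⋀^Fin 0]→ₗ[A] A) (v : M) :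
    (S.diff 0 P).curryLeft v = S.lieDer v P := by
  ext w
  rw [AlternatingMap.curryLeft_apply_apply, diff_apply, diffFun_cons_zero,
    Subsingleton.elim w Fin.elim0]
  rfl

theorem lieDer_map_add (v : M) (P Q : M [⋀^Fin n]→ₗ[A] A) :
    S.lieDer v (P + Q) = S.lieDer v P + S.lieDer v Q := by
  ext w
  simp only [lieDer_apply, AlternatingMap.add_apply, map_add, Finset.sum_add_distrib]
  ring

theorem lieDer_map_sub (v : M) (P Q : M [⋀^Fin n]→ₗ[A] A) :
    S.lieDer v (P - Q) = S.lieDer v P - S.lieDer v Q := by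
  ext w
  simp only [lieDer_apply, AlternatingMap.sub_apply, map_sub, Finset.sum_sub_distrib]
  ring

/-- The remaining axioms of a Lie algebroid. -/
structure IsLieAlgebroid : Prop where
  jacobi : ∀ u v w, S.bracket u (S.bracket v w) =
    S.bracket (S.bracket u v) w + S.bracket v (S.bracket u w)
  anchor_bracket : ∀ u v, S.anchor (S.bracket u v) = ⁅S.anchor u, S.anchor v⁆

theorem ext_curryLeft {P Q : M [⋀^Fin (n + 1)]→ₗ[A] A}
    (h : ∀ v, P.curryLeft v = Q.curryLeft v) : P = Q := by
  ext w
  rw [← Fin.cons_self_tail w]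
  exact congrArg (fun R => R (Fin.tail w)) (h (w 0))

variable {S}

theorem IsLieAlgebroid.lieDer_lieDer (hS : S.IsLieAlgebroid) (u v : M)
    (P : M [⋀^Fin n]→ₗ[A] A) :
    S.lieDer u (S.lieDer v P) - S.lieDer v (S.lieDer u P) = S.lieDer (S.bracket u v) P := by
  induction n with
  | zero =>
    ext w
    simp [lieDer_apply, hS.anchor_bracket, Derivation.commutator_apply]
  | succ n ih =>
    refine ext_curryLeft fun x => ?_
    have e : ∀ P Q : M [⋀^Fin (n + 1)]→ₗ[A] A, (P - Q).curryLeft x =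
      P.curryLeft x - Q.curryLeft x := fun _ _ => rfl
    simp only [e, lieDer_curryLeft, lieDer_map_sub, ← ih, hS.jacobi u v x, map_add]
    abel

theorem IsLieAlgebroid.lieDer_diff (hS : S.IsLieAlgebroid) (v : M)
    (P : M [⋀^Fin n]→ₗ[A] A) :
    S.lieDer v (S.diff n P) = S.diff n (S.lieDer v P) := by
  induction n with
  | zero =>
    refine ext_curryLeft fun x => ?_
    simp only [lieDer_curryLeft, diff_curryLeft_zero, ← hS.lieDer_lieDer]
    abel
  | succ n ih =>
    refine ext_curryLeft fun x => ?_
    simp only [lieDer_curryLeft, diff_curryLeft, lieDer_map_sub, ih, map_sub,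
      ← hS.lieDer_lieDer]
    abel

theorem IsLieAlgebroid.diff_diff (hS : S.IsLieAlgebroid) (P : M [⋀^Fin n]→ₗ[A] A) :
    S.diff (n + 1) (S.diff n P) = 0 := by
  induction n with
  | zero =>
    refine ext_curryLeft fun x => ?_
    rw [diff_curryLeft, diff_curryLeft_zero, hS.lieDer_diff, sub_self]
    rfl
  | succ n ih =>
    refine ext_curryLeft fun x => ?_
    rw [diff_curryLeft, diff_curryLeft, hS.lieDer_diff, map_sub, ih]
    simp

end AlmostLieAlgebroid

/-- The subquotient `Z / (Z ∩ B)` of a vector space. -/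
def Subquotient {V : Type*} [AddCommGroup V] [Module ℂ V] (Z B : Submodule ℂ V) : Type _ :=
  Z ⧸ B.comap Z.subtype

namespace Subquotient

variable {V V' : Type*} [AddCommGroup V] [Module ℂ V] [AddCommGroup V'] [Module ℂ V']

instance (Z B : Submodule ℂ V) : AddCommGroup (Subquotient Z B) :=
  inferInstanceAs (AddCommGroup (Z ⧸ B.comap Z.subtype))

instance (Z B : Submodule ℂ V) : Module ℂ (Subquotient Z B) :=
  inferInstanceAs (Module ℂ (Z ⧸ B.comap Z.subtype))

/-- The class of an element of `Z`. -/
def mk (Z B : Submodule ℂ V) : Z →ₗ[ℂ] Subquotient Z B :=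
  (B.comap Z.subtype).mkQ

/-- The map of subquotients induced by a linear map. -/
def map {Z B : Submodule ℂ V} {Z' B' : Submodule ℂ V'} (f : V →ₗ[ℂ] V')
    (hZ : ∀ x ∈ Z, f x ∈ Z') (hB : ∀ x ∈ B, f x ∈ B') : Subquotient Z B →ₗ[ℂ] Subquotient Z' B' :=
  Submodule.mapQ _ _ (f.restrict hZ) fun _ hx => hB _ hx

end Subquotient

namespace AlmostLieAlgebroid

variable {A M : Type*} [CommRing A] [Algebra ℂ A] [AddCommGroup M] [Module A M]
    [Module ℂ M]

/-- Sum of anchors and of brackets; the differentials add up as well. -/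
instance : Add (AlmostLieAlgebroid A M) where
  add S T :=
    { anchor := S.anchor + T.anchor
      bracket := S.bracket + T.bracket
      bracket_self := fun v => by simp [S.bracket_self, T.bracket_self]
      bracket_smul := fun v w f => by
        simp only [LinearMap.add_apply, S.bracket_smul, T.bracket_smul, smul_add,
          Derivation.add_apply, add_smul]
        abel }

theorem add_anchor (S T : AlmostLieAlgebroid A M) : (S + T).anchor = S.anchor + T.anchor := rfl

theorem add_bracket (S T : AlmostLieAlgebroid A M) : (S + T).bracket = S.bracket + T.bracket := rfl

theorem add_diff (S T : AlmostLieAlgebroid A M) (n : ℕ) :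
    (S + T).diff n = S.diff n + T.diff n := by
  ext P w
  simp only [LinearMap.add_apply, AlternatingMap.add_apply, diff_apply, diffFun,
    ← Finset.sum_add_distrib, add_anchor, add_bracket]
  refine Finset.sum_congr rfl fun i _ => ?_
  rw [← mul_add, sub_add_sub_comm, ← Finset.sum_add_distrib]
  congr 2
  refine Finset.sum_congr rfl fun j _ => ?_
  split_ifs <;> simp

/-- Closed forms of degree `q`. -/
def cocycles (S : AlmostLieAlgebroid A M) (q : ℕ) : Submodule ℂ (M [⋀^Fin q]→ₗ[A] A) :=
  LinearMap.ker (S.diff q)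

/-- Exact forms of degree `q`. -/
def coboundaries (S : AlmostLieAlgebroid A M) : ∀ q : ℕ, Submodule ℂ (M [⋀^Fin q]→ₗ[A] A)
  | 0 => ⊥
  | q + 1 => LinearMap.range (S.diff q)

/-- Closed forms modulo exact forms. -/
abbrev cohomology (S : AlmostLieAlgebroid A M) (q : ℕ) : Type _ :=
  Subquotient (S.cocycles q) (S.coboundaries q)

/-- Let `M = M₀ ⊕ M₁`, so that `∧ⁿ M* = ⊕_{p+q=n} ∧^p M₁* ⊗ ∧^q M₀*`. The `p`-th step of the
filtration consists of the forms all of whose components have degree at least `p` in `M₁`, that is,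
of the forms that vanish as soon as fewer than `p` arguments are in `M₁` and all others
in `M₀`. -/
def filtration (M₀ M₁ : Submodule A M) (p : ℤ) (n : ℕ) : Submodule ℂ (M [⋀^Fin n]→ₗ[A] A) where
  carrier := {P | ∀ (s : Finset (Fin n)) (w : Fin n → M), (s.card : ℤ) < p →
    (∀ i ∈ s, w i ∈ M₁) → (∀ i ∉ s, w i ∈ M₀) → P w = 0}
  add_mem' hP hQ s w hs h1 h0 := by simp [hP s w hs h1 h0, hQ s w hs h1 h0]
  zero_mem' s w hs h1 h0 := by simp
  smul_mem' c P hP s w hs h1 h0 := by simp [hP s w hs h1 h0]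

theorem filtration_anti (M₀ M₁ : Submodule A M) {p q : ℤ} (h : p ≤ q) (n : ℕ) :
    filtration M₀ M₁ q n ≤ filtration M₀ M₁ p n :=
  fun _ hP s w hs => hP s w (hs.trans_le h)

theorem filtration_of_nonpos (M₀ M₁ : Submodule A M) {p : ℤ} (h : p ≤ 0) (n : ℕ) :
    filtration M₀ M₁ p n = ⊤ :=
  eq_top_iff.2 fun _ _ s _ hs => by omega

theorem diff_mem_filtration (S : AlmostLieAlgebroid A M) {M₀ M₁ : Submodule A M}
    (hM : Codisjoint M₀ M₁) (h₀ : ∀ u ∈ M₀, ∀ v ∈ M₀, S.bracket u v ∈ M₀) {p : ℤ} {n : ℕ}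
    {P : M [⋀^Fin n]→ₗ[A] A} (hP : P ∈ filtration M₀ M₁ p n) :
    S.diff n P ∈ filtration M₀ M₁ p (n + 1) := by
  intro s w hs h1 h0
  rw [diff_apply, diffFun]
  refine Finset.sum_eq_zero fun i _ => ?_
  set t : Finset (Fin n) := Finset.univ.filter fun j => i.succAbove j ∈ s with ht
  have ht1 : ∀ j ∈ t, i.removeNth w j ∈ M₁ := fun j hj => h1 _ (by simpa [ht] using hj)
  have ht0 : ∀ j ∉ t, i.removeNth w j ∈ M₀ := fun j hj => h0 _ (by simpa [ht] using hj)
  have himg : t.map i.succAboveEmb ⊆ s := by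
    intro k hk
    obtain ⟨j, hj, rfl⟩ := Finset.mem_map.1 hk
    simpa [ht] using hj
  have hcard : (t.card : ℤ) < p := by
    have := Finset.card_le_card himg
    rw [Finset.card_map] at this
    omega
  rw [hP t _ hcard ht1 ht0, map_zero, zero_sub, mul_neg, neg_eq_zero]
  refine mul_eq_zero_of_right _ (Finset.sum_eq_zero fun j _ => ?_)
  split_ifs with hij
  swap
  · rfl
  have key0 : ∀ x ∈ M₀, P (update (i.removeNth w) j x) = 0 := by
    intro x hx
    refine hP (t.erase j) _ ?_ ?_ ?_
    · have := Finset.card_erase_le (s := t) (a := j)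
      omega
    · intro k hk
      have hk := Finset.mem_erase.1 hk
      rw [update_of_ne hk.1]
      exact ht1 k hk.2
    · intro k hk
      rcases eq_or_ne k j with rfl | hkj
      · simpa using hx
      · rw [update_of_ne hkj]
        exact ht0 k fun h => hk (Finset.mem_erase.2 ⟨hkj, h⟩)
  by_cases hcase : i ∈ s ∨ i.succAbove j ∈ s
  · have hcard' : ((insert j t).card : ℤ) < p := by
      rcases hcase with hi | hj
      · have h2 : t.map i.succAboveEmb ⊆ s.erase i := by
          intro k hk
          refine Finset.mem_erase.2 ⟨?_, himg hk⟩
          obtain ⟨j, hj, rfl⟩ := Finset.mem_map.1 hk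
          exact Fin.succAbove_ne i j
        have h3 := Finset.card_le_card h2
        rw [Finset.card_map] at h3
        have h4 := Finset.card_erase_add_one hi
        have h5 := Finset.card_insert_le j t
        omega
      · rwa [Finset.insert_eq_of_mem (by simpa [ht] using hj)]
    obtain ⟨x, hx, y, hy, hxy⟩ := Submodule.mem_sup.1
      (show S.bracket (w i) (w (i.succAbove j)) ∈ M₀ ⊔ M₁ by
        rw [hM.eq_top]; exact Submodule.mem_top)
    rw [← hxy, P.map_update_add, key0 x hx, zero_add]
    refine hP (insert j t) _ hcard' ?_ ?_
    · intro k hk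
      rcases eq_or_ne k j with rfl | hkj
      · simpa using hy
      · rw [update_of_ne hkj]
        exact ht1 k (Finset.mem_of_mem_insert_of_ne hk hkj)
    · intro k hk
      rw [update_of_ne fun h => hk (by simp [h])]
      exact ht0 k fun h => hk (Finset.mem_insert_of_mem h)
  · push Not at hcase
    exact key0 _ (h₀ _ (h0 _ hcase.1) _ (h0 _ hcase.2))

end AlmostLieAlgebroid

/-- A complex of complex vector spaces in degrees `0, 1, 2, …` with a decreasing filtration by
subcomplexes. -/
structure FilteredComplex where
  K : ℕ → Type*
  [addCommGroup : ∀ n, AddCommGroup (K n)]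
  [module : ∀ n, Module ℂ (K n)]
  d : ∀ n, K n →ₗ[ℂ] K (n + 1)
  d_d : ∀ n x, d (n + 1) (d n x) = 0
  F : ℤ → ∀ n, Submodule ℂ (K n)
  F_anti : ∀ p n, F (p + 1) n ≤ F p n
  d_mem_F : ∀ p n, ∀ x ∈ F p n, d n x ∈ F p (n + 1)

namespace FilteredComplex

attribute [instance] FilteredComplex.addCommGroup FilteredComplex.module

variable (C : FilteredComplex)

/-- `Z_r^{p,n-p} = F^p Kⁿ ∩ d⁻¹(F^{p+r} Kⁿ⁺¹)`. -/
def Z (r p : ℤ) (n : ℕ) : Submodule ℂ (C.K n) :=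
  C.F p n ⊓ (C.F (p + r) (n + 1)).comap (C.d n)

/-- The image `d(Z_r^p Kⁿ⁻¹)` in `Kⁿ`. -/
def dZ (r p : ℤ) : ∀ n : ℕ, Submodule ℂ (C.K n)
  | 0 => ⊥
  | n + 1 => (C.Z r p n).map (C.d n)

/-- The denominator `Z_{r-1}^{p+1} + d Z_{r-1}^{p-r+1}` of the `r`-th page, in total degree `n`. -/
def W (r p : ℤ) (n : ℕ) : Submodule ℂ (C.K n) :=
  C.Z (r - 1) (p + 1) n ⊔ C.dZ (r - 1) (p - r + 1) n

/-- The spectral sequence of the filtered complex: `E r p n` is the space `E_r^{p,q}` with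
`p + q = n`. -/
abbrev E (r p : ℤ) (n : ℕ) : Type _ :=
  Subquotient (C.Z r p n) (C.W r p n)

theorem d_mem_Z {r p : ℤ} {n : ℕ} {x : C.K n} (hx : x ∈ C.Z r p n) :
    C.d n x ∈ C.Z r (p + r) (n + 1) := by
  refine ⟨hx.2, ?_⟩
  change C.d _ _ ∈ C.F _ _
  rw [C.d_d]
  exact zero_mem _

theorem d_mem_W {r p : ℤ} {n : ℕ} {x : C.K n} (hx : x ∈ C.W r p n) :
    C.d n x ∈ C.W r (p + r) (n + 1) := by
  obtain ⟨y, hy, z, hz, rfl⟩ := Submodule.mem_sup.1 hx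
  have hz0 : C.d n z = 0 := by
    cases n with
    | zero => rw [(Submodule.mem_bot ℂ).1 hz, map_zero]
    | succ n => obtain ⟨u, -, rfl⟩ := hz; exact C.d_d n u
  rw [map_add, hz0, add_zero]
  refine Submodule.mem_sup_right ⟨y, ?_, rfl⟩
  rwa [add_sub_cancel_right]

/-- The differential `d_r^{p,q}` of the `r`-th page, induced by `d`; here `p + q = n`. -/
def dPage (r p : ℤ) (n : ℕ) : C.E r p n →ₗ[ℂ] C.E r (p + r) (n + 1) :=
  Subquotient.map (C.d n) (fun _ => C.d_mem_Z) fun _ => C.d_mem_W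

/-- Degeneration at page `r₀`: the differentials of this page and of all later ones vanish. -/
def DegeneratesAt (r₀ : ℤ) : Prop :=
  ∀ r : ℤ, r₀ ≤ r → ∀ (p : ℤ) (n : ℕ), C.dPage r p n = 0

end FilteredComplex

/-- A splitting of the complex vector fields into those of type `(1,0)` and those of type `(0,1)`,
both closed under the Lie bracket. -/
structure TangentSplitting (A : Type*) [CommRing A] [Algebra ℂ A] where
  T10 : Submodule A (Derivation ℂ A A)
  T01 : Submodule A (Derivation ℂ A A)
  isCompl : IsCompl T10 T01
  lie_mem_T10 : ∀ V ∈ T10, ∀ W ∈ T10, ⁅V, W⁆ ∈ T10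
  lie_mem_T01 : ∀ V ∈ T01, ∀ W ∈ T01, ⁅V, W⁆ ∈ T01

namespace TangentSplitting

variable {A : Type*} [CommRing A] [Algebra ℂ A] (J : TangentSplitting A)

/-- The `(1,0)` part of a vector field. -/
noncomputable def pr10 : Derivation ℂ A A →ₗ[A] J.T10 := J.T10.projectionOnto J.T01 J.isCompl

/-- The `(0,1)` part of a vector field. -/
noncomputable def pr01 : Derivation ℂ A A →ₗ[A] J.T01 := J.T01.projectionOnto J.T10 J.isCompl.symm

@[simp] theorem pr10_T10 (V : J.T10) : J.pr10 V = V := by simp [pr10]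
@[simp] theorem pr01_T01 (V : J.T01) : J.pr01 V = V := by simp [pr01]
@[simp] theorem pr10_T01 (V : J.T01) : J.pr10 V = 0 := by simp [pr10]
@[simp] theorem pr01_T10 (V : J.T10) : J.pr01 V = 0 := by simp [pr01]

theorem pr10_add_pr01 (V : Derivation ℂ A A) : (J.pr10 V : Derivation ℂ A A) + J.pr01 V = V :=
  Submodule.projection_add_projection_eq_self J.isCompl V

theorem lie_smul_der (V W : Derivation ℂ A A) (f : A) : ⁅V, f • W⁆ = f • ⁅V, W⁆ + V f • W := by
  simp

theorem smul_lie_der (V W : Derivation ℂ A A) (f : A) : ⁅f • V, W⁆ = f • ⁅V, W⁆ - W f • V := by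
  ext; simp [Derivation.commutator_apply]; ring

variable (A) in
/-- The complexified tangent bundle; its differential is the exterior derivative `d`. -/
noncomputable def tangentAlgebroid : AlmostLieAlgebroid A (Derivation ℂ A A) where
  anchor := LinearMap.id
  bracket := LinearMap.mk₂ ℂ (fun V W => ⁅V, W⁆) (by simp) (by simp) (by simp) (by simp)
  bracket_self V := lie_self V
  bracket_smul V W f := lie_smul_der V W f

/-- The bundle `T^{0,1}`; its differential is `∂̄` on forms of type `(0,q)`. -/
noncomputable def T01Algebroid : AlmostLieAlgebroid A J.T01 where
  anchor := J.T01.subtype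
  bracket := LinearMap.mk₂ ℂ (fun V W => ⟨⁅(V : Derivation ℂ A A), (W : Derivation ℂ A A)⁆,
      J.lie_mem_T01 V V.2 W W.2⟩)
    (fun _ _ _ => by ext1; simp) (fun _ _ _ => by ext1; simp)
    (fun _ _ _ => by ext1; simp) (fun _ _ _ => by ext1; simp)
  bracket_self V := by ext1; simp
  bracket_smul V W f := by ext1; simp

/-- The differential forms of type `(1,0)`. -/
abbrev Form10 : Type _ := Module.Dual A J.T10

/-- The Lie derivative of a `(1,0)`-form, followed by the projection to type `(1,0)`. -/
noncomputable def lieForm : Derivation ℂ A A →ₗ[ℂ] J.Form10 →ₗ[ℂ] J.Form10 :=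
  LinearMap.mk₂ ℂ (fun V η =>
    { toFun := fun Z => V (η Z) - η (J.pr10 ⁅V, (Z : Derivation ℂ A A)⁆)
      map_add' := fun Z W => by simp; ring
      map_smul' := fun f Z => by simp; ring })
    (fun _ _ _ => by ext; simp; ring) (fun _ _ _ => by ext; simp [smul_sub])
    (fun _ _ _ => by ext; simp; ring) (fun _ _ _ => by ext; simp [smul_sub])

theorem lieForm_apply (V : Derivation ℂ A A) (η : J.Form10) (Z : J.T10) :
    J.lieForm V η Z = V (η Z) - η (J.pr10 ⁅V, (Z : Derivation ℂ A A)⁆) := rfl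

/-- The `(1,0)`-form `∂f`. -/
noncomputable def del : A →ₗ[ℂ] J.Form10 where
  toFun f := { toFun := fun Z => (Z : Derivation ℂ A A) f, map_add' := by simp, map_smul' := by simp }
  map_add' _ _ := by ext; simp
  map_smul' _ _ := by ext; simp

theorem del_apply (f : A) (Z : J.T10) : J.del f Z = (Z : Derivation ℂ A A) f := rfl

theorem ext_form10 {V W : J.T10} (h : ∀ η : J.Form10, η V = η W) : V = W := by
  ext f
  exact h (J.del f)

theorem lieForm_smul_right (V : Derivation ℂ A A) (η : J.Form10) (f : A) :
    J.lieForm V (f • η) = f • J.lieForm V η + V f • η := by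
  ext Z; simp [lieForm_apply]; ring

theorem lieForm_smul_left (V : Derivation ℂ A A) (η : J.Form10) (f : A) :
    J.lieForm (f • V) η = f • J.lieForm V η + η (J.pr10 V) • J.del f := by
  ext Z; simp [lieForm_apply, smul_lie_der, del_apply]; ring

/-- The sections of `T^{0,1} ⊕ T^{*1,0}`. Alternating forms on this module are the sections of
`∧ⁿ(T^{1,0} ⊕ T^{*0,1})`. -/
abbrev Lbar : Type _ := J.T01 × J.Form10

/-- The bracket `[X̄ + ω, Ȳ + η] = [X̄, Ȳ] + L_X̄ η - L_Ȳ ω`, with anchor `X̄ + ω ↦ X̄`.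
Its differential is `∂̄`. -/
noncomputable def LbarAlgebroid : AlmostLieAlgebroid A J.Lbar where
  anchor := J.T01.subtype ∘ₗ LinearMap.fst A _ _
  bracket := LinearMap.mk₂ ℂ (fun v w => (J.T01Algebroid.bracket v.1 w.1,
      J.lieForm v.1 w.2 - J.lieForm w.1 v.2))
    (fun _ _ _ => by ext1 <;> simp; abel) (fun _ _ _ => by ext1 <;> simp [smul_sub])
    (fun _ _ _ => by ext1 <;> simp; abel) (fun _ _ _ => by ext1 <;> simp [smul_sub])
  bracket_self v := by ext1 <;> simp [J.T01Algebroid.bracket_self]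
  bracket_smul v w f := by
    ext1
    · exact J.T01Algebroid.bracket_smul v.1 w.1 f
    · simp [lieForm_smul_right, lieForm_smul_left, smul_sub]
      abel

/-- A bivector field of type `(2,0)`, given by its contraction `ω ↦ Λω` with `(1,0)`-forms, where
`(X ∧ Y)ω = ω(X)Y - ω(Y)X`. -/
structure Bivector where
  sharp : J.Form10 →ₗ[A] J.T10
  apply_sharp_self : ∀ ω : J.Form10, ω (sharp ω) = 0

variable {J}

theorem Bivector.skew (Λ : J.Bivector) (ω η : J.Form10) : η (Λ.sharp ω) = - ω (Λ.sharp η) := by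
  have h := Λ.apply_sharp_self (ω + η)
  simp only [map_add, LinearMap.add_apply, Λ.apply_sharp_self, zero_add, add_zero] at h
  exact eq_neg_of_add_eq_zero_left h

/-- The bracket derived from a bivector field, with anchor `X̄ + ω ↦ Λω`:
`[ω, η] = L_{Λω} η - L_{Λη} ω - ∂(η(Λω))` (the Koszul bracket), `[ω, Ȳ] = [Λω, Ȳ]^{0,1}` and
`[X̄, Ȳ] = 0`. Its differential is the Schouten bracket with `Λ`. -/
noncomputable def Bivector.algebroid (Λ : J.Bivector) : AlmostLieAlgebroid A J.Lbar where
  anchor := J.T10.subtype ∘ₗ Λ.sharp ∘ₗ LinearMap.snd A _ _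
  bracket := LinearMap.mk₂ ℂ (fun v w =>
      (J.pr01 ⁅(Λ.sharp v.2 : Derivation ℂ A A), (w.1 : Derivation ℂ A A)⁆
        - J.pr01 ⁅(Λ.sharp w.2 : Derivation ℂ A A), (v.1 : Derivation ℂ A A)⁆,
      J.lieForm (Λ.sharp v.2) w.2 - J.lieForm (Λ.sharp w.2) v.2 - J.del (w.2 (Λ.sharp v.2))))
    (fun _ _ _ => by ext1 <;> simp <;> abel)
    (fun c _ _ => by ext1 <;> simp [smul_sub])
    (fun _ _ _ => by ext1 <;> simp <;> abel) (fun _ _ _ => by ext1 <;> simp [smul_sub])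
  bracket_self v := by ext1 <;> simp [Λ.apply_sharp_self]
  bracket_smul v w f := by
    ext1
    · simp [smul_lie_der, smul_sub]
      abel
    · have h1 : J.del (f * v.2 (Λ.sharp w.2)) =
          f • J.del (v.2 (Λ.sharp w.2)) + v.2 (Λ.sharp w.2) • J.del f := by
        ext; simp [del_apply]
      simp [lieForm_smul_right, lieForm_smul_left, smul_sub, h1, Λ.skew v.2 w.2]
      abel

variable (J) in
/-- The operator `∂̄` on sections of `∧ⁿ(T^{1,0} ⊕ T^{*0,1})`. -/
noncomputable def dbar (n : ℕ) : (J.Lbar [⋀^Fin n]→ₗ[A] A) →ₗ[ℂ] (J.Lbar [⋀^Fin (n + 1)]→ₗ[A] A) :=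
  J.LbarAlgebroid.diff n

/-- The operator `ad_Λ = [Λ, ·]`, the Schouten bracket, on sections of `∧ⁿ(T^{1,0} ⊕ T^{*0,1})`.
For `Λ = X ∧ Y` it is `P ↦ X ∧ [Y, P] - Y ∧ [X, P]`, see `wedgeBivector_ad`. -/
noncomputable def Bivector.ad (Λ : J.Bivector) (n : ℕ) :
    (J.Lbar [⋀^Fin n]→ₗ[A] A) →ₗ[ℂ] (J.Lbar [⋀^Fin (n + 1)]→ₗ[A] A) :=
  Λ.algebroid.diff n

/-- The bivector field as an element of `∧²(T^{1,0} ⊕ T^{*0,1})`: `Λ(ω, η) = η(Λω)`. -/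
def Bivector.form (Λ : J.Bivector) : J.Lbar [⋀^Fin 2]→ₗ[A] A where
  toFun w := (w 1).2 (Λ.sharp (w 0).2)
  map_update_add' {inst} w i x y := by
    obtain rfl : inst = instDecidableEqFin 2 := Subsingleton.elim _ _
    fin_cases i <;> simp
  map_update_smul' {inst} w i f x := by
    obtain rfl : inst = instDecidableEqFin 2 := Subsingleton.elim _ _
    fin_cases i <;> simp
  map_eq_zero_of_eq' w i j h hij := by
    have : w 1 = w 0 := by
      fin_cases i <;> fin_cases j <;> simp_all
    simp [this, Λ.apply_sharp_self]

/-- Holomorphic Poisson structures: `∂̄Λ = 0` and `[Λ, Λ] = 0`. -/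
structure Bivector.IsHolomorphicPoisson (Λ : J.Bivector) : Prop where
  holomorphic : J.dbar 2 Λ.form = 0
  poisson : Λ.ad 2 Λ.form = 0

theorem diff_two {M : Type*} [AddCommGroup M] [Module A M] [Module ℂ M]
    (S : AlmostLieAlgebroid A M) (P : M [⋀^Fin 2]→ₗ[A] A) (u v w : M) :
    S.diff 2 P ![u, v, w] = S.anchor u (P ![v, w]) - S.anchor v (P ![u, w])
      + S.anchor w (P ![u, v]) - P ![S.bracket u v, w] - P ![v, S.bracket u w]
      + P ![u, S.bracket v w] := by
  rw [AlmostLieAlgebroid.diff_apply]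
  change S.diffFun P (Fin.cons u (Fin.cons v (Fin.cons w Fin.elim0))) = _
  rw [AlmostLieAlgebroid.diffFun_cons, AlmostLieAlgebroid.diffFun_cons,
    AlmostLieAlgebroid.diffFun_cons_zero]
  have hc : ∀ (x : M) {k : ℕ} (w : Fin k → M),
      (Fin.cons x w : Fin (k + 1) → M) = Matrix.vecCons x w := fun _ _ _ => rfl
  have he : (Fin.elim0 : Fin 0 → M) = ![] := rfl
  have hu : update ![v, w] 1 (S.bracket u w) = ![v, S.bracket u w] := by
    ext i; fin_cases i <;> rfl
  have hu0 : update ![v, w] 0 (S.bracket u v) = ![S.bracket u v, w] := by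
    ext i; fin_cases i <;> rfl
  have hu1 : update ![w] 0 (S.bracket v w) = ![S.bracket v w] := by
    ext i; fin_cases i; rfl
  simp [AlmostLieAlgebroid.lieDer_apply, Fin.sum_univ_two, hc, he, hu, hu0, hu1]
  ring

theorem Bivector.IsHolomorphicPoisson.lie_T01 {Λ : J.Bivector} (h : Λ.IsHolomorphicPoisson)
    (X : J.T01) (ω : J.Form10) :
    J.pr10 ⁅(X : Derivation ℂ A A), (Λ.sharp ω : Derivation ℂ A A)⁆ =
      Λ.sharp (J.lieForm X ω) := by
  refine J.ext_form10 fun η => ?_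
  have := congrArg (fun P => P ![((X, 0) : J.Lbar), (0, ω), (0, η)]) h.holomorphic
  simp [dbar, diff_two, LbarAlgebroid, Bivector.form] at this
  rw [lieForm_apply] at this
  linear_combination this

theorem Bivector.IsHolomorphicPoisson.lie_T10 {Λ : J.Bivector} (h : Λ.IsHolomorphicPoisson)
    (ω η : J.Form10) :
    J.pr10 ⁅(Λ.sharp ω : Derivation ℂ A A), (Λ.sharp η : Derivation ℂ A A)⁆ =
      Λ.sharp (J.lieForm (Λ.sharp ω) η - J.lieForm (Λ.sharp η) ω - J.del (η (Λ.sharp ω))) := by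
  refine J.ext_form10 fun ζ => ?_
  have := congrArg (fun P => P ![((0, ω) : J.Lbar), (0, η), (0, ζ)]) h.poisson
  simp [Bivector.ad, diff_two, Bivector.algebroid, Bivector.form] at this
  have hK := Λ.skew (J.lieForm (Λ.sharp ω) η - J.lieForm (Λ.sharp η) ω - J.del (η (Λ.sharp ω))) ζ
  have hlie : ∀ V W : J.T10, ⁅(V : Derivation ℂ A A), (W : Derivation ℂ A A)⁆ =
    -⁅(W : Derivation ℂ A A), (V : Derivation ℂ A A)⁆ := fun V W => (lie_skew _ _).symm
  set K := ζ (Λ.sharp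
    (J.lieForm (Λ.sharp ω) η - J.lieForm (Λ.sharp η) ω - J.del (η (Λ.sharp ω)))) with hKdef
  simp only [map_sub] at hKdef
  simp only [lieForm_apply, del_apply, LinearMap.sub_apply, hlie (Λ.sharp ζ), map_neg,
    LinearMap.neg_apply, hlie (Λ.sharp η) (Λ.sharp ω), Λ.skew ω η, Λ.skew ω ζ, Λ.skew η ζ] at this hK
  simp only [Λ.skew ω η, map_neg] at hKdef
  have h2 : (2 : ℂ) • (ζ (J.pr10 ⁅(Λ.sharp ω : Derivation ℂ A A),
      (Λ.sharp η : Derivation ℂ A A)⁆) - K) = 0 := by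
    rw [two_smul]
    linear_combination this - hK - hKdef
  exact sub_eq_zero.1 ((smul_eq_zero.1 h2).resolve_left two_ne_zero)

/-- The Dorfman bracket `[V + α, W + β] = [V, W] + L_V β - ι_W dα`; it serves to prove the Jacobi
identity below. -/
noncomputable def dorfman (a b : Derivation ℂ A A × (Derivation ℂ A A →ₗ[ℂ] A)) :
    Derivation ℂ A A × (Derivation ℂ A A →ₗ[ℂ] A) :=
  (⁅a.1, b.1⁆,
    { toFun := fun W => a.1 (b.2 W) - b.2 ⁅a.1, W⁆
        - (b.1 (a.2 W) - W (a.2 b.1) - a.2 ⁅b.1, W⁆)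
      map_add' := fun V W => by simp; ring
      map_smul' := fun c V => by simp [smul_sub] })

theorem dorfman_jacobi (a b c : Derivation ℂ A A × (Derivation ℂ A A →ₗ[ℂ] A)) :
    dorfman a (dorfman b c) = dorfman (dorfman a b) c + dorfman b (dorfman a c) := by
  ext1
  · simp [dorfman]
  · ext W
    simp only [dorfman, LinearMap.coe_mk, AddHom.coe_mk, Prod.snd_add, LinearMap.add_apply,
      map_sub, Derivation.commutator_apply]
    rw [show ⁅⁅a.1, b.1⁆, W⁆ = ⁅a.1, ⁅b.1, W⁆⁆ - ⁅b.1, ⁅a.1, W⁆⁆ from lie_lie _ _ _,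
      show ⁅⁅a.1, c.1⁆, W⁆ = ⁅a.1, ⁅c.1, W⁆⁆ - ⁅c.1, ⁅a.1, W⁆⁆ from lie_lie _ _ _,
      show ⁅⁅b.1, c.1⁆, W⁆ = ⁅b.1, ⁅c.1, W⁆⁆ - ⁅c.1, ⁅b.1, W⁆⁆ from lie_lie _ _ _,
      ← lie_skew c.1 W]
    simp only [map_sub, map_neg]
    ring

/-- The map `X̄ + ω ↦ X̄ + Λω + ω`. -/
noncomputable def Bivector.embed (Λ : J.Bivector) :
    J.Lbar →ₗ[ℂ] Derivation ℂ A A × (Derivation ℂ A A →ₗ[ℂ] A) where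
  toFun v := ((v.1 : Derivation ℂ A A) + Λ.sharp v.2, (v.2 ∘ₗ J.pr10).restrictScalars ℂ)
  map_add' v w := by ext <;> simp; ring
  map_smul' c v := by ext <;> simp

theorem Bivector.embed_injective (Λ : J.Bivector) : Function.Injective Λ.embed := by
  intro v w h
  have h1 : ∀ W, v.2 (J.pr10 W) = w.2 (J.pr10 W) := fun W =>
    congrArg (fun a => a.2 W) h
  have h2 : v.2 = w.2 := by
    ext Z; simpa using h1 Z
  have h3 : (v.1 : Derivation ℂ A A) + Λ.sharp v.2 = w.1 + Λ.sharp w.2 := congrArg Prod.fst h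
  rw [h2] at h3
  exact Prod.ext (Subtype.ext (add_right_cancel h3)) h2

theorem Bivector.embed_fst (Λ : J.Bivector) (v : J.Lbar) :
    (Λ.embed v).1 = (v.1 : Derivation ℂ A A) + Λ.sharp v.2 := rfl

theorem Bivector.embed_snd (Λ : J.Bivector) (v : J.Lbar) (W : Derivation ℂ A A) :
    (Λ.embed v).2 W = v.2 (J.pr10 W) := rfl

theorem dorfman_fst (a b : Derivation ℂ A A × (Derivation ℂ A A →ₗ[ℂ] A)) :
    (dorfman a b).1 = ⁅a.1, b.1⁆ := rfl

theorem dorfman_snd (a b : Derivation ℂ A A × (Derivation ℂ A A →ₗ[ℂ] A))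
    (W : Derivation ℂ A A) :
    (dorfman a b).2 W = a.1 (b.2 W) - b.2 ⁅a.1, W⁆
        - (b.1 (a.2 W) - W (a.2 b.1) - a.2 ⁅b.1, W⁆) := rfl

theorem Bivector.algebroid_add_bracket (Λ : J.Bivector) (v w : J.Lbar) :
    (J.LbarAlgebroid + Λ.algebroid).bracket v w =
      (J.T01Algebroid.bracket v.1 w.1 +
        (J.pr01 ⁅(Λ.sharp v.2 : Derivation ℂ A A), (w.1 : Derivation ℂ A A)⁆
        - J.pr01 ⁅(Λ.sharp w.2 : Derivation ℂ A A), (v.1 : Derivation ℂ A A)⁆),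
       (J.lieForm v.1 w.2 - J.lieForm w.1 v.2) +
        (J.lieForm (Λ.sharp v.2) w.2 - J.lieForm (Λ.sharp w.2) v.2
          - J.del (w.2 (Λ.sharp v.2)))) := rfl

theorem pr10_lie_T01 (X Y : J.T01) :
    J.pr10 ⁅(X : Derivation ℂ A A), (Y : Derivation ℂ A A)⁆ = 0 :=
  J.pr10_T01 ⟨_, J.lie_mem_T01 X X.2 Y Y.2⟩

theorem pr10_lie_T10 (X Y : J.T10) :
    (J.pr10 ⁅(X : Derivation ℂ A A), (Y : Derivation ℂ A A)⁆ : Derivation ℂ A A) =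
      ⁅(X : Derivation ℂ A A), (Y : Derivation ℂ A A)⁆ :=
  congrArg Subtype.val (J.pr10_T10 ⟨_, J.lie_mem_T10 X X.2 Y Y.2⟩)

theorem Bivector.IsHolomorphicPoisson.embed_bracket {Λ : J.Bivector}
    (h : Λ.IsHolomorphicPoisson) (v w : J.Lbar) :
    Λ.embed ((J.LbarAlgebroid + Λ.algebroid).bracket v w) = dorfman (Λ.embed v) (Λ.embed w) := by
  obtain ⟨X, ω⟩ := v
  obtain ⟨Y, η⟩ := w
  rw [Λ.algebroid_add_bracket]
  ext1
  · rw [dorfman_fst, embed_fst, embed_fst, embed_fst]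
    simp only [map_add, ← h.lie_T10 ω η]
    rw [map_sub, ← h.lie_T01, ← h.lie_T01]
    have e1 := J.pr10_add_pr01 ⁅(X : Derivation ℂ A A), (Λ.sharp η : Derivation ℂ A A)⁆
    have e2 := J.pr10_add_pr01 ⁅(Y : Derivation ℂ A A), (Λ.sharp ω : Derivation ℂ A A)⁆
    have e3 : J.pr01 ⁅(Λ.sharp η : Derivation ℂ A A), (X : Derivation ℂ A A)⁆ =
        - J.pr01 ⁅(X : Derivation ℂ A A), (Λ.sharp η : Derivation ℂ A A)⁆ := by
      rw [← lie_skew, map_neg]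
    have e4 : J.pr01 ⁅(Λ.sharp ω : Derivation ℂ A A), (Y : Derivation ℂ A A)⁆ =
        - J.pr01 ⁅(Y : Derivation ℂ A A), (Λ.sharp ω : Derivation ℂ A A)⁆ := by
      rw [← lie_skew, map_neg]
    have e5 : ((J.T01Algebroid.bracket X Y : J.T01) : Derivation ℂ A A) =
        ⁅(X : Derivation ℂ A A), (Y : Derivation ℂ A A)⁆ := rfl
    rw [e3, e4]
    simp only [Submodule.coe_add, Submodule.coe_sub, pr10_lie_T10, lie_add, add_lie,
      Submodule.coe_neg, e5]
    have e6 : ⁅(Λ.sharp ω : Derivation ℂ A A), (Y : Derivation ℂ A A)⁆ =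
        -⁅(Y : Derivation ℂ A A), (Λ.sharp ω : Derivation ℂ A A)⁆ := (lie_skew _ _).symm
    rw [e6]
    generalize ⁅(X : Derivation ℂ A A), (Λ.sharp η : Derivation ℂ A A)⁆ = V at e1 ⊢
    generalize ⁅(Y : Derivation ℂ A A), (Λ.sharp ω : Derivation ℂ A A)⁆ = W at e2 ⊢
    rw [← sub_eq_zero]
    linear_combination (norm := skip) e1 - e2
    abel
  · refine LinearMap.ext fun W => ?_
    rw [← J.pr10_add_pr01 W, map_add, map_add]
    congr 1
    · generalize J.pr10 W = Z
      simp only [embed_snd, dorfman_snd, pr10_T10, embed_fst, map_add, add_lie, pr10_T01,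
        lieForm_apply, del_apply, LinearMap.add_apply, LinearMap.sub_apply, Derivation.add_apply,
        Λ.skew ω η, map_neg, LinearMap.neg_apply, map_zero]
      ring
    · generalize J.pr01 W = N
      have e := Λ.skew ω (J.lieForm N η)
      have e' := Λ.skew ω η
      rw [lieForm_apply, h.lie_T01] at e
      simp only [embed_snd, dorfman_snd, pr10_T10, embed_fst, map_add, lie_add, pr10_T01,
        pr10_lie_T01, map_zero, zero_add, ← lie_skew _ (N : Derivation ℂ A A), map_neg, h.lie_T01]
      rw [e', map_neg] at e
      linear_combination e

theorem Bivector.IsHolomorphicPoisson.isLieAlgebroid {Λ : J.Bivector}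
    (h : Λ.IsHolomorphicPoisson) : (J.LbarAlgebroid + Λ.algebroid).IsLieAlgebroid where
  jacobi u v w := by
    apply Λ.embed_injective
    rw [map_add]
    rw [h.embed_bracket, h.embed_bracket, h.embed_bracket, h.embed_bracket, h.embed_bracket,
      h.embed_bracket, dorfman_jacobi]
  anchor_bracket u v := by
    have := congrArg Prod.fst (h.embed_bracket u v)
    exact this

end TangentSplitting

namespace TangentSplitting

variable {A : Type*} [CommRing A] [Algebra ℂ A] {J : TangentSplitting A}

theorem tangent_isLieAlgebroid : (tangentAlgebroid A).IsLieAlgebroid where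
  jacobi u v w := by simp [tangentAlgebroid]
  anchor_bracket u v := rfl

theorem T01_isLieAlgebroid : J.T01Algebroid.IsLieAlgebroid where
  jacobi u v w := by ext1; simp [T01Algebroid]
  anchor_bracket u v := rfl

variable (J) in
/-- The complex of differential forms with the exterior derivative, filtered by type: `F^p` is the
sum of the spaces of forms of type `(p',q)` with `p' ≥ p`. Its spectral sequence is the
Frölicher spectral sequence. -/
noncomputable def frolicherComplex : FilteredComplex where
  K n := Derivation ℂ A A [⋀^Fin n]→ₗ[A] A
  d n := (tangentAlgebroid A).diff n
  d_d _ P := tangent_isLieAlgebroid.diff_diff P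
  F p n := AlmostLieAlgebroid.filtration J.T01 J.T10 p n
  F_anti _ n := AlmostLieAlgebroid.filtration_anti _ _ (by omega) n
  d_mem_F _ _ _ hP := AlmostLieAlgebroid.diff_mem_filtration _ J.isCompl.symm.codisjoint
    (fun u hu v hv => J.lie_mem_T01 u hu v hv) hP

variable (J) in
/-- The part `T^{0,1}` of `T^{0,1} ⊕ T^{*1,0}`. -/
def LbarT01 : Submodule A J.Lbar := Submodule.prod ⊤ ⊥

variable (J) in
/-- The part `T^{*1,0}` of `T^{0,1} ⊕ T^{*1,0}`. -/
def LbarForm10 : Submodule A J.Lbar := Submodule.prod ⊥ ⊤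

theorem codisjoint_Lbar : Codisjoint J.LbarT01 J.LbarForm10 := by
  rw [codisjoint_iff, LbarT01, LbarForm10, Submodule.prod_sup_prod]
  simp

theorem Bivector.IsHolomorphicPoisson.diff_diff {Λ : J.Bivector}
    (h : Λ.IsHolomorphicPoisson) {n : ℕ} (P : J.Lbar [⋀^Fin n]→ₗ[A] A) :
    (J.dbar (n + 1) + Λ.ad (n + 1)) ((J.dbar n + Λ.ad n) P) = 0 := by
  rw [dbar, Bivector.ad, ← AlmostLieAlgebroid.add_diff, dbar, Bivector.ad, ← AlmostLieAlgebroid.add_diff,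
    h.isLieAlgebroid.diff_diff]

/-- The complex of sections of `∧ⁿ(T^{1,0} ⊕ T^{*0,1})` with the differential
`∂̄_Λ = ∂̄ + ad_Λ`, the total complex of the double complex of the spaces
`A^{p,q} = C^∞(∧^p T^{1,0} ⊗ ∧^q T^{*0,1})`. It is filtered by `F^p = ⊕_{p' ≥ p} A^{p',q}`. -/
noncomputable def poissonComplex (Λ : J.Bivector) (h : Λ.IsHolomorphicPoisson) :
    FilteredComplex where
  K n := J.Lbar [⋀^Fin n]→ₗ[A] A
  d n := J.dbar n + Λ.ad n
  d_d _ P := h.diff_diff P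
  F p n := AlmostLieAlgebroid.filtration J.LbarT01 J.LbarForm10 p n
  F_anti _ n := AlmostLieAlgebroid.filtration_anti _ _ (by omega) n
  d_mem_F p n P hP := by
    rw [dbar, Bivector.ad, ← AlmostLieAlgebroid.add_diff]
    refine AlmostLieAlgebroid.diff_mem_filtration _ codisjoint_Lbar (fun u hu v hv => ?_) hP
    have hu2 : u.2 = 0 := hu.2
    have hv2 : v.2 = 0 := hv.2
    refine ⟨trivial, ?_⟩
    rw [Λ.algebroid_add_bracket]
    simp [hu2, hv2]

variable (J) in
/-- The `∂̄`-closed differential forms of type `(0,q)`. -/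
noncomputable abbrev dolbeaultCocycles (q : ℕ) : Submodule ℂ (J.T01 [⋀^Fin q]→ₗ[A] A) :=
  J.T01Algebroid.cocycles q

variable (J) in
/-- The Dolbeault cohomology `H^q(𝒪) = H^{0,q}`: the `∂̄`-closed forms of type `(0,q)` modulo the
`∂̄`-exact ones. -/
noncomputable def DolbeaultCohomology (q : ℕ) : Type _ := J.T01Algebroid.cohomology q

noncomputable instance (q : ℕ) : AddCommGroup (J.DolbeaultCohomology q) :=
  inferInstanceAs (AddCommGroup (J.T01Algebroid.cohomology q))

noncomputable instance (q : ℕ) : Module ℂ (J.DolbeaultCohomology q) :=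
  inferInstanceAs (Module ℂ (J.T01Algebroid.cohomology q))

variable (J) in
/-- The class of a `∂̄`-closed form. -/
noncomputable def dolbeaultClass (q : ℕ) : J.dolbeaultCocycles q →ₗ[ℂ] J.DolbeaultCohomology q :=
  Subquotient.mk _ _

/-- The component of type `(0,q)` of a section of `∧^q(T^{1,0} ⊕ T^{*0,1})`, as a differential form
on `T^{0,1}`. -/
def restrict {q : ℕ} (P : J.Lbar [⋀^Fin q]→ₗ[A] A) : J.T01 [⋀^Fin q]→ₗ[A] A :=
  P.compLinearMap (LinearMap.inl A J.T01 J.Form10)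

end TangentSplitting

namespace AlmostLieAlgebroid

variable {A M : Type*} [CommRing A] [Algebra ℂ A] [AddCommGroup M] [Module A M]
    [Module ℂ M] {n : ℕ}

/-- The exterior product with a form of degree one on the left. -/
def wedge (a : M →ₗ[A] A) (P : M [⋀^Fin n]→ₗ[A] A) : M [⋀^Fin (n + 1)]→ₗ[A] A :=
  AlternatingMap.alternatizeUncurryFin (a.smulRight P)

theorem wedge_apply (a : M →ₗ[A] A) (P : M [⋀^Fin n]→ₗ[A] A) (w : Fin (n + 1) → M) :
    wedge a P w = ∑ i : Fin (n + 1), (-1) ^ (i : ℕ) * (a (w i) * P (i.removeNth w)) := by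
  rw [wedge, AlternatingMap.alternatizeUncurryFin_apply]
  refine Finset.sum_congr rfl fun i _ => ?_
  rw [← Int.cast_smul_eq_zsmul A]
  simp

theorem wedge_curryLeft (a : M →ₗ[A] A) (P : M [⋀^Fin (n + 1)]→ₗ[A] A) (v : M) :
    (wedge a P).curryLeft v = a v • P - wedge a (P.curryLeft v) := by
  ext w
  change wedge a P (Fin.cons v w) = _
  rw [wedge_apply, Fin.sum_univ_succ, AlternatingMap.sub_apply, wedge_apply, sub_eq_add_neg,
    ← Finset.sum_neg_distrib]
  congr 1
  · simp
  · refine Finset.sum_congr rfl fun i _ => ?_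
    simp only [removeNth_succ_cons, Fin.cons_succ, Fin.val_succ, pow_succ,
      AlternatingMap.curryLeft_apply_apply, Matrix.vecCons]
    ring

theorem wedge_curryLeft_zero (a : M →ₗ[A] A) (P : M [⋀^Fin 0]→ₗ[A] A) (v : M) :
    (wedge a P).curryLeft v = a v • P := by
  ext w
  change wedge a P (Fin.cons v w) = _
  rw [wedge_apply]
  simp

end AlmostLieAlgebroid

namespace TangentSplitting
variable {A : Type*} [CommRing A] [Algebra ℂ A] {J : TangentSplitting A}

/-- The Lie derivative along a `(1,0)`-field on `T^{0,1} ⊕ T^{*1,0}`. -/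
noncomputable def lieLbar (Y : J.T10) : J.Lbar →ₗ[ℂ] J.Lbar where
  toFun v := (J.pr01 ⁅(Y : Derivation ℂ A A), (v.1 : Derivation ℂ A A)⁆, J.lieForm Y v.2)
  map_add' v w := by ext1 <;> simp
  map_smul' c v := by ext1 <;> simp

theorem lieLbar_smul (Y : J.T10) (v : J.Lbar) (f : A) :
    lieLbar Y (f • v) = f • lieLbar Y v + (Y : Derivation ℂ A A) f • v := by
  ext1 <;> simp [lieLbar, lieForm_smul_right]

end TangentSplitting

namespace TangentSplitting
open AlmostLieAlgebroid
variable {A : Type*} [CommRing A] [Algebra ℂ A] {J : TangentSplitting A} {n : ℕ}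

/-- The bivector field `X ∧ Y`. -/
def wedgeBivector (X Y : J.T10) : J.Bivector where
  sharp :=
    { toFun := fun ω => ω X • Y - ω Y • X
      map_add' := fun _ _ => by simp [add_smul]; abel
      map_smul' := fun _ _ => by simp [mul_smul, smul_sub] }
  apply_sharp_self ω := by simp [mul_comm]

/-- The bracket `[Y, P]`, the Lie derivative along a `(1,0)`-field. -/
noncomputable def lieMulti (Y : J.T10) (P : J.Lbar [⋀^Fin n]→ₗ[A] A) :
    J.Lbar [⋀^Fin n]→ₗ[A] A :=
  derAlt (Y : Derivation ℂ A A) (lieLbar Y) (lieLbar_smul Y) P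

/-- A `(1,0)`-field as a form of degree one on `T^{0,1} ⊕ T^{*1,0}`. -/
noncomputable def evalForm (X : J.T10) : J.Lbar →ₗ[A] A :=
  (Module.Dual.eval A J.T10 X) ∘ₗ LinearMap.snd A _ _

theorem wedgeBivector_bracket (X Y : J.T10) (v w : J.Lbar) :
    (wedgeBivector X Y).algebroid.bracket v w =
      evalForm X v • lieLbar Y w - evalForm Y v • lieLbar X w
      - (evalForm X w • lieLbar Y v - evalForm Y w • lieLbar X v) := by
  ext1
  · simp [Bivector.algebroid, wedgeBivector, lieLbar, evalForm, smul_lie_der]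
  · ext Z
    simp [Bivector.algebroid, wedgeBivector, lieLbar, evalForm, lieForm_smul_left, lieForm_apply,
      del_apply]
    ring

theorem wedgeBivector_lieDer (X Y : J.T10) (v : J.Lbar)
    (P : J.Lbar [⋀^Fin (n + 1)]→ₗ[A] A) :
    (wedgeBivector X Y).algebroid.lieDer v P =
      evalForm X v • lieMulti Y P - evalForm Y v • lieMulti X P
      + wedge (evalForm X) (P.curryLeft (lieLbar Y v))
      - wedge (evalForm Y) (P.curryLeft (lieLbar X v)) := by
  ext w
  have ha : ∀ f, (wedgeBivector X Y).algebroid.anchor v f =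
      evalForm X v * (Y : Derivation ℂ A A) f - evalForm Y v * (X : Derivation ℂ A A) f :=
    fun f => by simp [Bivector.algebroid, wedgeBivector, evalForm]
  have hl : ∀ (Y : J.T10), lieMulti Y P w =
      (Y : Derivation ℂ A A) (P w) - ∑ i, P (update w i (lieLbar Y (w i))) := fun _ => rfl
  simp only [lieDer_apply, wedgeBivector_bracket, P.map_update_sub, P.map_update_smul,
    AlternatingMap.sub_apply, AlternatingMap.add_apply, AlternatingMap.smul_apply, wedge_apply, hl,
    Finset.sum_sub_distrib, smul_eq_mul, ← Finset.mul_sum, ha]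
  simp only [map_update_eq P w _ (lieLbar X v), map_update_eq P w _ (lieLbar Y v), mul_left_comm]
  ring

/-- `[X ∧ Y, P] = X ∧ [Y, P] - Y ∧ [X, P]`. -/
theorem wedgeBivector_ad (X Y : J.T10) (P : J.Lbar [⋀^Fin n]→ₗ[A] A) :
    (wedgeBivector X Y).ad n P =
      wedge (evalForm X) (lieMulti Y P) - wedge (evalForm Y) (lieMulti X P) := by
  have e : ∀ {k : ℕ} (P Q : J.Lbar [⋀^Fin (k + 1)]→ₗ[A] A) x, (P - Q).curryLeft x =
      P.curryLeft x - Q.curryLeft x := fun _ _ _ => rfl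
  have hc : ∀ {k : ℕ} (Y : J.T10) (P : J.Lbar [⋀^Fin (k + 1)]→ₗ[A] A) (v : J.Lbar),
      (lieMulti Y P).curryLeft v = lieMulti Y (P.curryLeft v) - P.curryLeft (lieLbar Y v) := by
    intro k Y P v
    ext w
    exact derAlt_cons _ v P w
  have hw : ∀ {k : ℕ} (a : J.Lbar →ₗ[A] A) (P Q : J.Lbar [⋀^Fin k]→ₗ[A] A),
      wedge a (P - Q) = wedge a P - wedge a Q := by
    intro k a P Q
    ext w
    simp only [wedge_apply, AlternatingMap.sub_apply, mul_sub, Finset.sum_sub_distrib]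
  induction n with
  | zero =>
    refine ext_curryLeft fun v => ?_
    rw [Bivector.ad, diff_curryLeft_zero, e, wedge_curryLeft_zero, wedge_curryLeft_zero]
    ext w
    simp [lieDer_apply, lieMulti, derAlt, Bivector.algebroid, wedgeBivector, evalForm]
  | succ n ih =>
    refine ext_curryLeft fun v => ?_
    have ih' := ih (P.curryLeft v)
    rw [Bivector.ad] at ih' ⊢
    rw [diff_curryLeft, ih', wedgeBivector_lieDer, e, wedge_curryLeft, wedge_curryLeft, hc, hc,
      hw, hw]
    abel

end TangentSplitting

open scoped Manifold ContDiff Topology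

section Hadamard

open Set MeasureTheory

universe u
variable {E : Type u} [NormedAddCommGroup E] [NormedSpace ℝ E] [FiniteDimensional ℝ E]

theorem contDiff_integral_param (n : ℕ) : ∀ {F : Type u} [NormedAddCommGroup F] [NormedSpace ℝ F]
    {G : E → ℝ → F}, ContDiff ℝ ∞ (Function.uncurry G) →
    ContDiff ℝ n (fun x => ∫ t in (0 : ℝ)..1, G x t) := by
  induction n with
  | zero =>
    intro F _ _ G hG
    exact contDiff_zero.2
      (intervalIntegral.continuous_parametric_intervalIntegral_of_continuous' hG.continuous 0 1)
  | succ n ih =>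
    intro F _ _ G hG
    let G' : E → ℝ → E →L[ℝ] F := fun x t =>
      (fderiv ℝ (Function.uncurry G) (x, t)).comp (ContinuousLinearMap.inl ℝ E ℝ)
    have hG' : ContDiff ℝ ∞ (Function.uncurry G') := by
      have h1 : ContDiff ℝ ∞ (fderiv ℝ (Function.uncurry G)) := hG.fderiv_right (by simp)
      exact h1.clm_comp contDiff_const
    have hd : ∀ x t, HasFDerivAt (fun x => G x t) (G' x t) x := by
      intro x t
      have h1 := (hG.differentiable (by simp) (x, t)).hasFDerivAt
      exact HasFDerivAt.comp (f := fun e => (e, t)) (g := Function.uncurry G) x h1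
        (hasFDerivAt_prodMk_left x t)
    have hcont : ∀ x, Continuous (G x) := fun x =>
      hG.continuous.comp (by fun_prop : Continuous fun t : ℝ => (x, t))
    have hcont' : ∀ x, Continuous (G' x) := fun x =>
      hG'.continuous.comp (by fun_prop : Continuous fun t : ℝ => (x, t))
    have key : ∀ x₀, HasFDerivAt (fun x => ∫ t in (0 : ℝ)..1, G x t)
        (∫ t in (0 : ℝ)..1, G' x₀ t) x₀ := by
      intro x₀
      obtain ⟨C, hC⟩ := ((isCompact_closedBall x₀ 1).prod
        (isCompact_Icc (a := (0 : ℝ)) (b := 1))).exists_bound_of_continuousOn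
        hG'.continuous.continuousOn
      refine intervalIntegral.hasFDerivAt_integral_of_dominated_of_fderiv_le
        (bound := fun _ => C) (s := Metric.closedBall x₀ 1)
        (Metric.closedBall_mem_nhds _ one_pos) ?_ ?_ ?_ ?_ ?_ ?_
      · exact Filter.Eventually.of_forall fun x => (hcont x).aestronglyMeasurable
      · exact (hcont x₀).intervalIntegrable _ _
      · exact (hcont' x₀).aestronglyMeasurable
      · refine Filter.Eventually.of_forall fun t ht x hx => ?_
        rw [uIoc_of_le zero_le_one] at ht
        exact hC (x, t) ⟨hx, Ioc_subset_Icc_self ht⟩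
      · exact intervalIntegrable_const
      · exact Filter.Eventually.of_forall fun t _ x _ => hd x t
    push_cast
    rw [contDiff_succ_iff_fderiv]
    refine ⟨fun x => (key x).differentiableAt, fun h => by simp at h, ?_⟩
    have : fderiv ℝ (fun x => ∫ t in (0 : ℝ)..1, G x t) = fun x => ∫ t in (0 : ℝ)..1, G' x t :=
      funext fun x => (key x).fderiv
    rw [this]
    exact ih hG'

/-- Hadamard's lemma. -/
theorem exists_hadamard {f : E → ℂ} (hf : ContDiff ℝ ∞ f) (x₀ : E) :
    ∃ H : E → E →L[ℝ] ℂ, ContDiff ℝ ∞ H ∧ H x₀ = fderiv ℝ f x₀ ∧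
      ∀ x, f x = f x₀ + H x (x - x₀) := by
  have h1 : ContDiff ℝ ∞ (fderiv ℝ f) := hf.fderiv_right (by simp)
  have h2 : ContDiff ℝ ∞ (Function.uncurry fun (x : E) (t : ℝ) =>
      fderiv ℝ f (x₀ + t • (x - x₀))) := by
    refine h1.comp (g := fderiv ℝ f) (f := fun p : E × ℝ => x₀ + p.2 • (p.1 - x₀)) ?_
    fun_prop
  refine ⟨fun x => ∫ t in (0 : ℝ)..1, fderiv ℝ f (x₀ + t • (x - x₀)),
    contDiff_infty.2 fun n => contDiff_integral_param n h2, by simp, fun x => ?_⟩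
  have hc : Continuous fun t : ℝ => fderiv ℝ f (x₀ + t • (x - x₀)) :=
    h1.continuous.comp (by fun_prop)
  change f x = f x₀ + (∫ t in (0 : ℝ)..1, fderiv ℝ f (x₀ + t • (x - x₀))) (x - x₀)
  rw [ContinuousLinearMap.intervalIntegral_apply (hc.intervalIntegrable 0 1),
    intervalIntegral.integral_eq_sub_of_hasDerivAt (f := fun t : ℝ => f (x₀ + t • (x - x₀)))]
  · simp
  · intro t _
    have h3 := (hf.differentiable (by simp) (x₀ + t • (x - x₀))).hasFDerivAt
    have h4 : HasDerivAt (fun t : ℝ => x₀ + t • (x - x₀)) (x - x₀) t := by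
      simpa using ((hasDerivAt_id t).smul_const (x - x₀)).const_add x₀
    exact h3.comp_hasDerivAt t h4
  · exact (hc.clm_apply continuous_const).intervalIntegrable 0 1

end Hadamard

section ComplexManifold

open Filter Set

universe u v
variable (E : Type u) [NormedAddCommGroup E] [NormedSpace ℂ E]
  (X : Type v) [TopologicalSpace X] [ChartedSpace E X]

/-- The algebra of smooth complex valued functions on `X`. -/
def smoothFunctions : Subalgebra ℂ (X → ℂ) where
  carrier := {f | ContMDiff 𝓘(ℝ, E) 𝓘(ℝ, ℂ) ∞ f}
  mul_mem' hf hg :=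
    (contDiff_mul (𝕜 := ℝ) (𝔸 := ℂ)).contMDiff.comp (hf.prodMk_space hg)
  add_mem' hf hg :=
    (contDiff_add (𝕜 := ℝ) (F := ℂ)).contMDiff.comp (hf.prodMk_space hg)
  algebraMap_mem' _ := contMDiff_const

variable {X}

/-- The function `f` is holomorphic in a neighbourhood of `x`. -/
def HolomorphicNear (f : X → ℂ) (x : X) : Prop :=
  ∀ᶠ y in 𝓝 x, MDifferentiableAt 𝓘(ℂ, E) 𝓘(ℂ, ℂ) f y

variable (X)

/-- The complex vector fields of type `(1,0)`: those that annihilate antiholomorphic functions. -/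
def derivations10 : Submodule (smoothFunctions E X)
    (Derivation ℂ (smoothFunctions E X) (smoothFunctions E X)) where
  carrier := {V | ∀ (f : smoothFunctions E X) (x : X),
    HolomorphicNear E (fun y => star (f.1 y)) x → (V f).1 x = 0}
  add_mem' hV hW f x hf := by simp [hV f x hf, hW f x hf]
  zero_mem' f x hf := by simp
  smul_mem' g V hV f x hf := by simp [hV f x hf]

/-- The complex vector fields of type `(0,1)`: those that annihilate holomorphic functions. -/
def derivations01 : Submodule (smoothFunctions E X)
    (Derivation ℂ (smoothFunctions E X) (smoothFunctions E X)) where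
  carrier := {V | ∀ (f : smoothFunctions E X) (x : X),
    HolomorphicNear E f.1 x → (V f).1 x = 0}
  add_mem' hV hW f x hf := by simp [hV f x hf, hW f x hf]
  zero_mem' f x hf := by simp
  smul_mem' g V hV f x hf := by simp [hV f x hf]

variable {E X}

theorem HolomorphicNear.of_eventuallyEq_zero {f : X → ℂ} {x : X} (h : f =ᶠ[𝓝 x] 0) :
    HolomorphicNear E f x := by
  filter_upwards [h.eventually_nhds] with y hy
  exact (mdifferentiableAt_const (c := (0 : ℂ))).congr_of_eventuallyEq hy

theorem lie_mem_derivations01 (V : Derivation ℂ (smoothFunctions E X) (smoothFunctions E X))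
    (hV : V ∈ derivations01 E X)
    (W : Derivation ℂ (smoothFunctions E X) (smoothFunctions E X))
    (hW : W ∈ derivations01 E X) : ⁅V, W⁆ ∈ derivations01 E X := by
  intro f x hf
  have h : ∀ V ∈ derivations01 E X, ∀ W ∈ derivations01 E X, (V (W f)).1 x = 0 := by
    intro V hV W hW
    refine hV _ x (.of_eventuallyEq_zero ?_)
    filter_upwards [eventually_eventually_nhds.2 hf] with y hy
    exact hW f y hy
  rw [Derivation.commutator_apply]
  change (V (W f)).1 x - (W (V f)).1 x = 0
  rw [h V hV W hW, h W hW V hV, sub_zero]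

theorem lie_mem_derivations10 (V : Derivation ℂ (smoothFunctions E X) (smoothFunctions E X))
    (hV : V ∈ derivations10 E X)
    (W : Derivation ℂ (smoothFunctions E X) (smoothFunctions E X))
    (hW : W ∈ derivations10 E X) : ⁅V, W⁆ ∈ derivations10 E X := by
  intro f x hf
  have h : ∀ V ∈ derivations10 E X, ∀ W ∈ derivations10 E X, (V (W f)).1 x = 0 := by
    intro V hV W hW
    refine hV _ x (.of_eventuallyEq_zero ?_)
    filter_upwards [eventually_eventually_nhds.2 hf] with y hy
    simpa using hW f y hy
  rw [Derivation.commutator_apply]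
  change (V (W f)).1 x - (W (V f)).1 x = 0
  rw [h V hV W hW, h W hW V hV, sub_zero]

theorem contDiffOn_transition [IsManifold 𝓘(ℂ, E) ω X] {e e' : OpenPartialHomeomorph X E}
    (he : e ∈ atlas E X) (he' : e' ∈ atlas E X) :
    ContDiffOn ℂ ω (e.symm ≫ₕ e') (e.symm ≫ₕ e').source := by
  have h := (contDiffGroupoid ω 𝓘(ℂ, E)).compatible he he'
  rw [contDiffGroupoid, mem_groupoid_of_pregroupoid] at h
  have h1 := h.1
  simpa [contDiffPregroupoid] using h1

theorem isManifold_real [IsManifold 𝓘(ℂ, E) ω X] : IsManifold 𝓘(ℝ, E) ∞ X := by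
  refine isManifold_of_contDiffOn _ _ _ fun e e' he he' => ?_
  simpa using ((contDiffOn_transition he he').restrict_scalars ℝ).of_le le_top

/-- The differential of `f` at `x`, in the preferred chart at `x`. -/
noncomputable def chartDeriv (x : X) (f : smoothFunctions E X) : E →L[ℝ] ℂ :=
  fderiv ℝ (f.1 ∘ (chartAt E x).symm) (chartAt E x x)

section

variable [FiniteDimensional ℂ E] [T2Space X] [IsManifold 𝓘(ℂ, E) ω X]

/-- A globally defined function that agrees with `G` in the chart at `x`, near `x`. -/
noncomputable def extendFun (x : X) (G : E → ℂ) (hG : ContDiff ℝ ∞ G) : smoothFunctions E X :=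
  ⟨fun y => (Classical.arbitrary (SmoothBumpFunction 𝓘(ℝ, E) x)) y • G (chartAt E x y), by
    have : IsManifold 𝓘(ℝ, E) ∞ X := isManifold_real
    exact SmoothBumpFunction.contMDiff_smul (I := 𝓘(ℝ, E)) (G := ℂ)
      (g := fun y => G (chartAt E x y)) _ (hG.contMDiff.comp_contMDiffOn contMDiffOn_chart)⟩

theorem extendFun_eventuallyEq (x : X) (G : E → ℂ) (hG : ContDiff ℝ ∞ G) :
    (extendFun x G hG).1 =ᶠ[𝓝 x] fun y => G (chartAt E x y) := by
  filter_upwards [(Classical.arbitrary (SmoothBumpFunction 𝓘(ℝ, E) x)).eventuallyEq_one] with y hy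
  simp [extendFun, hy]

theorem derivation_congr (V : Derivation ℂ (smoothFunctions E X) (smoothFunctions E X))
    {f g : smoothFunctions E X} {x : X} (h : f.1 =ᶠ[𝓝 x] g.1) : (V f).1 x = (V g).1 x := by
  have : IsManifold 𝓘(ℝ, E) ∞ X := isManifold_real
  obtain ⟨χ, -, hχ⟩ := (SmoothBumpFunction.nhds_basis_support (I := 𝓘(ℝ, E)) h).mem_iff.1 h
  let c : smoothFunctions E X := ⟨fun y => χ y • (1 : ℂ),
    χ.contMDiff_smul (g := fun _ => (1 : ℂ)) contMDiffOn_const⟩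
  have h0 : c * (f - g) = 0 := by
    ext y
    by_cases hy : χ y = 0
    · simp [c, hy]
    · have : f.1 y = g.1 y := hχ hy
      simp [this]
  have h1 := congrArg (fun k : smoothFunctions E X => k.1 x) (congrArg V h0)
  have h2 : f.1 x = g.1 x := h.eq_of_nhds
  have h3 : c.1 x = 1 := by simp [c]
  simp [Derivation.leibniz, h2, h3] at h1
  exact sub_eq_zero.1 h1

theorem smooth_comp_symm (f : smoothFunctions E X) (x : X) :
    ContDiffOn ℝ ∞ (f.1 ∘ (chartAt E x).symm) (chartAt E x).target := by
  have : IsManifold 𝓘(ℝ, E) ∞ X := isManifold_real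
  exact (f.2.comp_contMDiffOn (contMDiffOn_chart_symm (I := 𝓘(ℝ, E)) (x := x))).contDiffOn

theorem exists_localRep (f : smoothFunctions E X) (x : X) :
    ∃ F : E → ℂ, ContDiff ℝ ∞ F ∧ F =ᶠ[𝓝 (chartAt E x x)] f.1 ∘ (chartAt E x).symm := by
  have ht : (chartAt E x).target ∈ 𝓝 (chartAt E x x) := chart_target_mem_nhds E x
  obtain ⟨r, hr, hsub⟩ := Metric.nhds_basis_closedBall.mem_iff.1 ht
  let β : ContDiffBump (chartAt E x x) := ⟨r / 2, r, by positivity, by linarith⟩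
  refine ⟨fun y => β y • (f.1 ∘ (chartAt E x).symm) y, ?_, ?_⟩
  · rw [contDiff_iff_contDiffAt]
    intro y
    by_cases hy : y ∈ (chartAt E x).target
    · exact β.contDiff.contDiffAt.smul
        ((smooth_comp_symm f x).contDiffAt ((chartAt E x).open_target.mem_nhds hy))
    · have : y ∉ tsupport β := by
        rw [β.tsupport_eq]; exact fun h => hy (hsub h)
      refine (contDiffAt_const (c := (0 : ℂ))).congr_of_eventuallyEq ?_
      filter_upwards [(isClosed_tsupport β).isOpen_compl.mem_nhds this] with z hz
      simp [image_eq_zero_of_notMem_tsupport hz]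
  · filter_upwards [β.eventuallyEq_one] with y hy
    simp [hy]

theorem eventually_chart {x : X} {p : E → Prop} (h : ∀ᶠ z in 𝓝 (chartAt E x x), p z) :
    ∀ᶠ y in 𝓝 x, p (chartAt E x y) :=
  ((chartAt E x).continuousAt (mem_chart_source E x)).eventually h

theorem localRep_eventuallyEq {f : smoothFunctions E X} {x : X} {F : E → ℂ}
    (hF : F =ᶠ[𝓝 (chartAt E x x)] f.1 ∘ (chartAt E x).symm) :
    f.1 =ᶠ[𝓝 x] fun y => F (chartAt E x y) := by
  filter_upwards [eventually_chart hF, chart_source_mem_nhds E x] with y hy hy'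
  rw [hy, Function.comp_apply, (chartAt E x).left_inv hy']

/-- A derivation kills functions whose differential vanishes at the point. -/
theorem derivation_eq_zero (V : Derivation ℂ (smoothFunctions E X) (smoothFunctions E X))
    {f : smoothFunctions E X} {x : X} (h : chartDeriv x f = 0) : (V f).1 x = 0 := by
  obtain ⟨F, hF, hFf⟩ := exists_localRep f x
  obtain ⟨H, hH, hH0, hFH⟩ := exists_hadamard hF (chartAt E x x)
  have hH0' : H (chartAt E x x) = 0 := by rw [hH0, hFf.fderiv_eq]; exact h
  let b := Module.finBasis ℝ E
  have hh : ∀ k, ContDiff ℝ ∞ fun y => H y (b k) := fun k => hH.clm_apply contDiff_const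
  have hm : ∀ k, ContDiff ℝ ∞ fun y =>
      (((b.coord k).toContinuousLinearMap (y - chartAt E x x) : ℝ) : ℂ) := fun k =>
    Complex.ofRealCLM.contDiff.comp
      ((ContinuousLinearMap.contDiff _).comp (contDiff_id.sub contDiff_const))
  let g : smoothFunctions E X := algebraMap ℂ _ (F (chartAt E x x)) +
    ∑ k, extendFun x _ (hh k) * extendFun x _ (hm k)
  have hsum : ∀ (s : Finset (Fin (Module.finrank ℝ E))) (a : Fin (Module.finrank ℝ E) →
      smoothFunctions E X) (y : X), (∑ k ∈ s, a k).1 y = ∑ k ∈ s, (a k).1 y := by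
    intro s a y
    simp
  have hfg : f.1 =ᶠ[𝓝 x] g.1 := by
    have h1 : ∀ᶠ y in 𝓝 x, ∀ k, (extendFun x _ (hh k)).1 y = H (chartAt E x y) (b k) :=
      eventually_all.2 fun k => extendFun_eventuallyEq x _ (hh k)
    have h2 : ∀ᶠ y in 𝓝 x, ∀ k, (extendFun x _ (hm k)).1 y =
        (((b.coord k).toContinuousLinearMap (chartAt E x y - chartAt E x x) : ℝ) : ℂ) :=
      eventually_all.2 fun k => extendFun_eventuallyEq x _ (hm k)
    filter_upwards [localRep_eventuallyEq hFf, h1, h2] with y hy hy1 hy2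
    rw [hy, hFH]
    change _ = F (chartAt E x x) + (∑ k, extendFun x _ (hh k) * extendFun x _ (hm k)).1 y
    rw [hsum]
    congr 1
    conv_lhs => rw [← b.sum_repr (chartAt E x y - chartAt E x x), map_sum]
    refine Finset.sum_congr rfl fun k _ => ?_
    change _ = (extendFun x _ (hh k)).1 y * (extendFun x _ (hm k)).1 y
    rw [hy1, hy2, map_smul, Complex.real_smul, mul_comm]
    rfl
  rw [derivation_congr V hfg, map_add, Derivation.map_algebraMap, zero_add, map_sum, hsum]
  refine Finset.sum_eq_zero fun k _ => ?_
  rw [Derivation.leibniz]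
  change (extendFun x _ (hh k)).1 x * _ + (extendFun x _ (hm k)).1 x * _ = 0
  rw [(extendFun_eventuallyEq x _ (hh k)).eq_of_nhds,
    (extendFun_eventuallyEq x _ (hm k)).eq_of_nhds]
  simp [hH0']

theorem differentiableAt_comp_symm (f : smoothFunctions E X) (x : X) :
    DifferentiableAt ℝ (f.1 ∘ (chartAt E x).symm) (chartAt E x x) :=
  ((smooth_comp_symm f x).contDiffAt (chart_target_mem_nhds E x)).differentiableAt (by simp)

theorem chartDeriv_sub (f g : smoothFunctions E X) (x : X) :
    chartDeriv x (f - g) = chartDeriv x f - chartDeriv x g :=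
  fderiv_sub (differentiableAt_comp_symm f x) (differentiableAt_comp_symm g x)

theorem derivation_congr_chartDeriv
    (V : Derivation ℂ (smoothFunctions E X) (smoothFunctions E X))
    {f g : smoothFunctions E X} {x : X} (h : chartDeriv x f = chartDeriv x g) :
    (V f).1 x = (V g).1 x := by
  have := derivation_eq_zero V (f := f - g) (x := x) (by rw [chartDeriv_sub, h, sub_self])
  rw [map_sub] at this
  exact sub_eq_zero.1 this

theorem chartDeriv_add (f g : smoothFunctions E X) (x : X) :
    chartDeriv x (f + g) = chartDeriv x f + chartDeriv x g :=
  fderiv_add (differentiableAt_comp_symm f x) (differentiableAt_comp_symm g x)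

theorem chartDeriv_mul (f g : smoothFunctions E X) (x : X) :
    chartDeriv x (f * g) = f.1 x • chartDeriv x g + g.1 x • chartDeriv x f := by
  have h := fderiv_mul (differentiableAt_comp_symm f x) (differentiableAt_comp_symm g x)
  have hx : (chartAt E x).symm (chartAt E x x) = x := (chartAt E x).left_inv (mem_chart_source E x)
  simp only [Function.comp_apply, hx] at h
  exact h

theorem chartDeriv_const_smul (c : ℂ) (f : smoothFunctions E X) (x : X) :
    chartDeriv x (c • f) = c • chartDeriv x f :=
  fderiv_const_smul (differentiableAt_comp_symm f x) c

variable (E) in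
/-- Multiplication by `i`. -/
noncomputable def mulI : E →L[ℝ] E := (Complex.I • ContinuousLinearMap.id ℂ E).restrictScalars ℝ

variable (E) in
/-- The antilinear part of a real linear form. -/
noncomputable def antilinearPart : (E →L[ℝ] ℂ) →ₗ[ℂ] (E →L[ℝ] ℂ) where
  toFun L := (1 / 2 : ℂ) • (L + Complex.I • L.comp (mulI E))
  map_add' L L' := by ext v; simp; ring
  map_smul' c L := by ext v; simp; ring

theorem antilinearPart_apply (L : E →L[ℝ] ℂ) (v : E) :
    antilinearPart E L v = (1 / 2 : ℂ) * (L v + Complex.I * L (Complex.I • v)) := rfl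

theorem antilinearPart_comp (L : E →L[ℝ] ℂ) (τ : E →L[ℂ] E) :
    antilinearPart E (L.comp (τ.restrictScalars ℝ)) =
      (antilinearPart E L).comp (τ.restrictScalars ℝ) := by
  ext v
  simp [antilinearPart_apply]

theorem antilinearPart_restrictScalars (L : E →L[ℂ] ℂ) :
    antilinearPart E (L.restrictScalars ℝ) = 0 := by
  ext v
  simp only [antilinearPart_apply, ContinuousLinearMap.coe_restrictScalars', map_smul, smul_eq_mul,
    zero_apply]
  linear_combination (1 / 2 * L v) * Complex.I_mul_I

/-- A global function that agrees with a real linear form in the chart at `x`, near `x`. -/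
noncomputable def extendLin (x : X) : (E →L[ℝ] ℂ) →ₗ[ℂ] smoothFunctions E X where
  toFun L := extendFun x L L.contDiff
  map_add' L L' := by ext y; simp [extendFun]
  map_smul' c L := by ext y; simp [extendFun]; ring

theorem extendLin_eventuallyEq (x : X) (L : E →L[ℝ] ℂ) :
    (extendLin x L).1 =ᶠ[𝓝 x] fun y => L (chartAt E x y) :=
  extendFun_eventuallyEq x L L.contDiff

theorem chartDeriv_of_eventuallyEq {f : smoothFunctions E X} {x y : X}
    (hy : y ∈ (chartAt E x).source) {F : E → ℂ} (hF : ContDiff ℝ ∞ F)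
    (h : f.1 =ᶠ[𝓝 y] fun z => F (chartAt E x z)) :
    ∃ τ : E →L[ℂ] E, HasFDerivAt ((chartAt E y).symm ≫ₕ chartAt E x) τ (chartAt E y y) ∧
      chartDeriv y f = (fderiv ℝ F (chartAt E x y)).comp (τ.restrictScalars ℝ) := by
  have hyy : (chartAt E y).symm (chartAt E y y) = y := (chartAt E y).left_inv (mem_chart_source E y)
  have hsrc : chartAt E y y ∈ ((chartAt E y).symm ≫ₕ chartAt E x).source := by
    simp [hy]
  have hτ := (((contDiffOn_transition (chart_mem_atlas E y) (chart_mem_atlas E x)).contDiffAt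
    (((chartAt E y).symm ≫ₕ chartAt E x).open_source.mem_nhds hsrc)).differentiableAt
    (by simp)).hasFDerivAt
  refine ⟨_, hτ, ?_⟩
  have hval : ((chartAt E y).symm ≫ₕ chartAt E x) (chartAt E y y) = chartAt E x y := by simp
  have h1 := (hF.differentiable (by simp) (((chartAt E y).symm ≫ₕ chartAt E x)
    (chartAt E y y))).hasFDerivAt
  have h2 := h1.comp _ (hτ.restrictScalars ℝ)
  rw [hval] at h2
  rw [← h2.fderiv, chartDeriv]
  refine Filter.EventuallyEq.fderiv_eq ?_
  have hc : Tendsto (chartAt E y).symm (𝓝 (chartAt E y y)) (𝓝 y) := by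
    have := (chartAt E y).continuousAt_symm (mem_chart_target E y)
    rwa [ContinuousAt, hyy] at this
  exact hc.eventually h

theorem chartDeriv_extendLin (x : X) (L : E →L[ℝ] ℂ) : chartDeriv x (extendLin x L) = L := by
  obtain ⟨τ, hτ, h⟩ := chartDeriv_of_eventuallyEq (mem_chart_source E x) L.contDiff
    (extendLin_eventuallyEq x L)
  have h1 : HasFDerivAt ((chartAt E x).symm ≫ₕ chartAt E x) (ContinuousLinearMap.id ℂ E)
      (chartAt E x x) := by
    refine (hasFDerivAt_id _).congr_of_eventuallyEq ?_
    filter_upwards [chart_target_mem_nhds E x] with z hz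
    simp [hz]
  rw [h, hτ.unique h1, ContinuousLinearMap.fderiv]
  ext v; simp

theorem chartDeriv_holomorphic {x : X} {g : X → ℂ}
    (h : HolomorphicNear E g x) :
    DifferentiableAt ℂ (g ∘ (chartAt E x).symm) (chartAt E x x) := by
  have := (mdifferentiableAt_iff _ _).1 h.self_of_nhds
  have h2 := this.2
  simp only [writtenInExtChartAt, mfld_simps] at h2
  exact differentiableWithinAt_univ.1 h2

theorem antilinearPart_chartDeriv {f : smoothFunctions E X} {x : X}
    (h : HolomorphicNear E f.1 x) : antilinearPart E (chartDeriv x f) = 0 := by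
  rw [chartDeriv, (chartDeriv_holomorphic h).fderiv_restrictScalars ℝ,
    antilinearPart_restrictScalars]

theorem antilinearPart_chartDeriv_star {f : smoothFunctions E X} {x : X}
    (h : HolomorphicNear E (fun y => star (f.1 y)) x) :
    antilinearPart E (chartDeriv x f) = chartDeriv x f := by
  have h1 := ((chartDeriv_holomorphic h).hasFDerivAt).restrictScalars ℝ
  have h2 := (Complex.conjCLE.toContinuousLinearMap.hasFDerivAt).comp _ h1
  have h3 : HasFDerivAt (f.1 ∘ (chartAt E x).symm) _ (chartAt E x x) :=
    h2.congr_of_eventuallyEq (.of_forall fun z => by simp)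
  rw [chartDeriv, h3.fderiv]
  ext v
  simp only [antilinearPart_apply, ContinuousLinearMap.comp_apply,
    ContinuousLinearMap.coe_restrictScalars', map_smul, smul_eq_mul]
  simp
  ring_nf
  simp
  ring

theorem holomorphicNear_of_linear {f : X → ℂ} {x : X} (L : E →L[ℂ] ℂ)
    (h : f =ᶠ[𝓝 x] fun y => L (chartAt E x y)) : HolomorphicNear E f x := by
  filter_upwards [h.eventually_nhds, chart_source_mem_nhds E x] with y hy hy'
  have h1 : MDifferentiableAt 𝓘(ℂ, E) 𝓘(ℂ, E) (chartAt E x) y :=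
    mdifferentiableAt_atlas (chart_mem_atlas E x) hy'
  exact (L.differentiableAt.mdifferentiableAt.comp y h1).congr_of_eventuallyEq hy

theorem exists_linear_of_antilinearPart {L : E →L[ℝ] ℂ} (h : antilinearPart E L = 0) :
    ∃ L' : E →L[ℂ] ℂ, L = L'.restrictScalars ℝ := by
  have h1 : ∀ v, L (Complex.I • v) = Complex.I * L v := fun v => by
    have := congrArg (fun M => M v) h
    simp only [antilinearPart_apply, zero_apply] at this
    linear_combination (-2 * Complex.I) * this + L (Complex.I • v) * Complex.I_mul_I
  refine ⟨{ toFun := L, map_add' := L.map_add, map_smul' := fun c v => ?_, cont := L.cont }, rfl⟩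
  have hc : c • v = c.re • v + c.im • (Complex.I • v) := by
    conv_lhs => rw [← Complex.re_add_im c]
    rw [add_smul, mul_smul]
    rfl
  rw [hc, map_add, map_smul, map_smul, h1]
  simp only [Complex.real_smul, RingHom.id_apply, smul_eq_mul]
  conv_rhs => rw [← Complex.re_add_im c]
  ring

theorem antilinearPart_idem (L : E →L[ℝ] ℂ) :
    antilinearPart E (antilinearPart E L) = antilinearPart E L := by
  ext v
  simp only [antilinearPart_apply, smul_smul, Complex.I_mul_I, neg_smul, one_smul, map_neg]
  linear_combination (-(1 / 4) * L v) * Complex.I_mul_I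

theorem disjoint_derivations : Disjoint (derivations10 E X) (derivations01 E X) := by
  rw [Submodule.disjoint_def]
  intro V h10 h01
  ext f x
  set L := chartDeriv x f
  have h1 : antilinearPart E (L - antilinearPart E L) = 0 := by
    rw [map_sub, antilinearPart_idem, sub_self]
  obtain ⟨L', hL'⟩ := exists_linear_of_antilinearPart h1
  have e1 : (V (extendLin x (L - antilinearPart E L))).1 x = 0 := by
    refine h01 _ x (holomorphicNear_of_linear L' ?_)
    have := extendLin_eventuallyEq x (L - antilinearPart E L)
    rw [hL'] at this
    rw [hL']
    exact this
  let M : E →L[ℝ] ℂ := Complex.conjCLE.toContinuousLinearMap.comp (antilinearPart E L)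
  have h2 : antilinearPart E M = 0 := by
    ext v
    have := congrArg (fun N => N v) (antilinearPart_idem L)
    simp only [antilinearPart_apply (antilinearPart E L)] at this
    have h3 : antilinearPart E L (Complex.I • v) = -Complex.I * antilinearPart E L v := by
      linear_combination (-2 * Complex.I) * this +
        antilinearPart E L (Complex.I • v) * Complex.I_mul_I
    rw [antilinearPart_apply M]
    simp only [M, ContinuousLinearMap.comp_apply, h3]
    simp [← mul_assoc]
  obtain ⟨M', hM'⟩ := exists_linear_of_antilinearPart h2
  have e2 : (V (extendLin x (antilinearPart E L))).1 x = 0 := by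
    refine h10 _ x (holomorphicNear_of_linear M' ?_)
    filter_upwards [extendLin_eventuallyEq x (antilinearPart E L)] with y hy
    rw [hy]
    exact congrArg (fun N => N (chartAt E x y)) hM'
  have e3 : (V f).1 x = (V (extendLin x L)).1 x :=
    derivation_congr_chartDeriv V (chartDeriv_extendLin x L).symm
  have e4 : L = (L - antilinearPart E L) + antilinearPart E L := by abel
  rw [e4, map_add, map_add] at e3
  rw [e3]
  change (V (extendLin x (L - antilinearPart E L))).1 x +
    (V (extendLin x (antilinearPart E L))).1 x = 0
  rw [e1, e2, add_zero]

/-- The tangent vector at `x` of a vector field, as a functional on differentials. -/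
noncomputable def derValue (V : Derivation ℂ (smoothFunctions E X) (smoothFunctions E X)) (x : X) :
    (E →L[ℝ] ℂ) →ₗ[ℂ] ℂ where
  toFun L := (V (extendLin x L)).1 x
  map_add' L L' := by simp
  map_smul' c L := by simp

theorem derValue_chartDeriv (V : Derivation ℂ (smoothFunctions E X) (smoothFunctions E X))
    (f : smoothFunctions E X) (x : X) : derValue V x (chartDeriv x f) = (V f).1 x :=
  (derivation_congr_chartDeriv V (chartDeriv_extendLin x _).symm).symm

theorem contMDiff_part01 (V : Derivation ℂ (smoothFunctions E X) (smoothFunctions E X))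
    (f : smoothFunctions E X) :
    ContMDiff 𝓘(ℝ, E) 𝓘(ℝ, ℂ) ∞
      fun x => derValue V x (antilinearPart E (chartDeriv x f)) := by
  have : IsManifold 𝓘(ℝ, E) ∞ X := isManifold_real
  intro x
  obtain ⟨F, hF, hFf⟩ := exists_localRep f x
  have : Module.Finite ℂ (E →L[ℝ] ℂ) := Module.Finite.of_restrictScalars_finite ℝ ℂ _
  let b := Module.finBasis ℂ (E →L[ℝ] ℂ)
  let c : Fin (Module.finrank ℂ (E →L[ℝ] ℂ)) → E → ℂ := fun k z =>
    ((b.coord k).restrictScalars ℝ).toContinuousLinearMap (fderiv ℝ F z)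
  have hc : ∀ k, ContDiff ℝ ∞ (c k) := fun k =>
    (ContinuousLinearMap.contDiff _).comp (hF.fderiv_right (by simp))
  let g : smoothFunctions E X := ∑ k, extendFun x (c k) (hc k) *
    V (extendLin x (antilinearPart E (b k)))
  refine (g.2 x).congr_of_eventuallyEq ?_
  have h1 : ∀ᶠ y in 𝓝 x, ∀ k, (extendFun x (c k) (hc k)).1 y = c k (chartAt E x y) :=
    eventually_all.2 fun k => extendFun_eventuallyEq x _ (hc k)
  have h2 : ∀ᶠ y in 𝓝 x, ∀ k, (extendLin x (antilinearPart E (b k))).1 =ᶠ[𝓝 y]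
      fun z => antilinearPart E (b k) (chartAt E x z) :=
    eventually_all.2 fun k => (extendLin_eventuallyEq x _).eventually_nhds
  filter_upwards [(localRep_eventuallyEq hFf).eventually_nhds, h1, h2, chart_source_mem_nhds E x]
    with y hy hy1 hy2 hys
  obtain ⟨τ, hτ, e⟩ := chartDeriv_of_eventuallyEq hys hF hy
  have hg : g.1 y = ∑ k, c k (chartAt E x y) *
      (V (extendLin x (antilinearPart E (b k)))).1 y := by
    simp only [← hy1]
    simp [g]
  rw [hg, e, antilinearPart_comp]
  have e2 : fderiv ℝ F (chartAt E x y) = ∑ k, c k (chartAt E x y) • b k :=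
    (b.sum_repr _).symm
  rw [e2, map_sum]
  have e3 : (∑ k, antilinearPart E (c k (chartAt E x y) • b k)).comp (τ.restrictScalars ℝ) =
      ∑ k, c k (chartAt E x y) • chartDeriv y (extendLin x (antilinearPart E (b k))) := by
    ext v
    simp only [ContinuousLinearMap.comp_apply, sum_apply, map_smul,
      smul_apply]
    refine Finset.sum_congr rfl fun k _ => ?_
    obtain ⟨τ', hτ', e'⟩ := chartDeriv_of_eventuallyEq hys
      (antilinearPart E (b k)).contDiff (hy2 k)
    rw [e', hτ'.unique hτ, ContinuousLinearMap.fderiv]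
    rfl
  rw [e3, map_sum]
  refine Finset.sum_congr rfl fun k _ => ?_
  rw [map_smul, derValue_chartDeriv, smul_eq_mul]

/-- The `(0,1)` part of a vector field. -/
noncomputable def part01 (V : Derivation ℂ (smoothFunctions E X) (smoothFunctions E X)) :
    Derivation ℂ (smoothFunctions E X) (smoothFunctions E X) :=
  Derivation.mk'
    { toFun := fun f => ⟨fun x => derValue V x (antilinearPart E (chartDeriv x f)),
        contMDiff_part01 V f⟩
      map_add' := fun f g => by ext x; simp [chartDeriv_add]
      map_smul' := fun c f => by ext x; simp [chartDeriv_const_smul] } fun f g => by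
    ext x
    simp [chartDeriv_mul]

theorem part01_apply (V : Derivation ℂ (smoothFunctions E X) (smoothFunctions E X))
    (f : smoothFunctions E X) (x : X) :
    (part01 V f).1 x = derValue V x (antilinearPart E (chartDeriv x f)) := rfl

theorem isCompl_derivations : IsCompl (derivations10 E X) (derivations01 E X) := by
  refine ⟨disjoint_derivations, ?_⟩
  rw [codisjoint_iff, eq_top_iff]
  intro V _
  refine Submodule.mem_sup.2 ⟨V - part01 V, ?_, part01 V, ?_, by abel⟩
  · intro f x hf
    change (V f).1 x - (part01 V f).1 x = 0
    rw [part01_apply, antilinearPart_chartDeriv_star hf, derValue_chartDeriv, sub_self]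
  · intro f x hf
    rw [part01_apply, antilinearPart_chartDeriv hf, map_zero]

variable (E X) in
/-- The splitting `T ⊗ ℂ = T^{1,0} ⊕ T^{0,1}` on a complex manifold `X` modelled on `E`. -/
noncomputable def tangentSplitting : TangentSplitting (smoothFunctions E X) where
  T10 := derivations10 E X
  T01 := derivations01 E X
  isCompl := isCompl_derivations
  lie_mem_T10 := lie_mem_derivations10
  lie_mem_T01 := lie_mem_derivations01

end

end ComplexManifold

/-!
The anchor `X̄ + ω ↦ X̄ + Λω` of the Lie algebroid `T^{0,1} ⊕ T^{*1,0}` is a morphism of Lie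
algebroids to the complexified tangent bundle. Hence pullback along it is a chain map from the
differential forms to the Poisson complex (`AlmostLieAlgebroid.diff_compLinearMap`); it respects the
filtrations and does not change the `(0,q)`-component of a form.

If the Frölicher spectral sequence degenerates at `E₁`, then every `∂̄`-closed `(0,q)`-form is the
`(0,q)`-component of a `d`-closed form
(`FilteredComplex.DegeneratesAt.exists_closed`). The pullback of the latter is a `∂̄_Λ`-closed
element of the Poisson complex with the same `(0,q)`-component. So in the Poisson complex every
element of `Z_1^{0,q}` is closed modulo `F¹`. This forces all differentials that start in the column
`p = 0` to vanish (`FilteredComplex.dPage_zero_eq_zero`); as there is nothing to the left of this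
column, its entries do not change from the first page on
(`FilteredComplex.exists_linearEquiv_E_one`).
-/

/-! ### Subquotients -/

namespace Subquotient

variable {V V' : Type*} [AddCommGroup V] [Module ℂ V] [AddCommGroup V'] [Module ℂ V']

theorem mk_eq_mk_iff {Z B : Submodule ℂ V} {x y : Z} :
    mk Z B x = mk Z B y ↔ (x : V) - y ∈ B :=
  Submodule.Quotient.eq _

theorem mk_eq_zero_iff {Z B : Submodule ℂ V} {x : Z} : mk Z B x = 0 ↔ (x : V) ∈ B :=
  Submodule.Quotient.mk_eq_zero _

theorem mk_surjective (Z B : Submodule ℂ V) : Function.Surjective (mk Z B) :=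
  Submodule.mkQ_surjective _

/-- A linear map induces an isomorphism of subquotients if it is injective and surjective modulo the
denominators. -/
theorem exists_linearEquiv {Z B : Submodule ℂ V} {Z' B' : Submodule ℂ V'} (f : V →ₗ[ℂ] V')
    (hZ : ∀ x ∈ Z, f x ∈ Z') (hB : ∀ x ∈ Z, f x ∈ B' ↔ x ∈ B)
    (hsurj : ∀ y ∈ Z', ∃ x ∈ Z, f x - y ∈ B') :
    ∃ e : Subquotient Z B ≃ₗ[ℂ] Subquotient Z' B',
      ∀ x : Z, e (mk Z B x) = mk Z' B' ⟨f x, hZ x x.2⟩ := by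
  let g : Z →ₗ[ℂ] Subquotient Z' B' := mk Z' B' ∘ₗ f.restrict hZ
  have hker : B.comap Z.subtype = LinearMap.ker g := by
    ext x
    rw [LinearMap.mem_ker]
    exact (mk_eq_zero_iff.trans (hB x x.2)).symm
  have hg : Function.Surjective g := by
    intro c
    obtain ⟨y, rfl⟩ := mk_surjective Z' B' c
    obtain ⟨x, hx, hxy⟩ := hsurj y y.2
    exact ⟨⟨x, hx⟩, mk_eq_mk_iff.2 hxy⟩
  exact ⟨(Submodule.quotEquivOfEq _ _ hker).trans (g.quotKerEquivOfSurjective hg),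
    fun x => rfl⟩

end Subquotient

/-! ### The column `p = 0` of the spectral sequence of a filtered complex -/

namespace FilteredComplex

variable {C : FilteredComplex}

theorem F_le {p p' : ℤ} (h : p ≤ p') (n : ℕ) : C.F p' n ≤ C.F p n :=
  antitone_int_of_succ_le (f := fun p => C.F p n) (fun p => C.F_anti p n) h

theorem d_eq_zero_of_mem_dZ {r p : ℤ} {n : ℕ} {x : C.K n} (hx : x ∈ C.dZ r p n) :
    C.d n x = 0 := by
  cases n with
  | zero => rw [(Submodule.mem_bot ℂ).1 hx, map_zero]
  | succ n => obtain ⟨u, -, rfl⟩ := hx; exact C.d_d n u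

/-- If the differentials of the pages `r ≥ 1` vanish, then an element of `F⁰` can be corrected in
`F¹` so that its differential, already in `F¹` at the start, lies as deep in the filtration as desired. -/
theorem DegeneratesAt.exists_mem_Z (hC : C.DegeneratesAt 1) {n : ℕ} {x : C.K n}
    (hx : x ∈ C.Z 1 0 n) (r : ℕ) : ∃ z ∈ C.Z (r + 1 : ℕ) 0 n, x - z ∈ C.F 1 n := by
  induction r with
  | zero => exact ⟨x, hx, by simp⟩
  | succ r ih =>
    obtain ⟨z, hz, hxz⟩ := ih
    have h0 : C.dPage (r + 1 : ℕ) 0 n (Subquotient.mk _ _ ⟨z, hz⟩) = 0 := by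
      rw [hC _ (by omega)]; rfl
    have hW : C.d n z ∈ C.W (r + 1 : ℕ) (0 + (r + 1 : ℕ)) (n + 1) :=
      Subquotient.mk_eq_zero_iff.1 h0
    obtain ⟨u, hu, _, ⟨v, hv, rfl⟩, huv⟩ := Submodule.mem_sup.1 hW
    have hv1 : v ∈ C.F 1 n := C.F_le (by omega) n hv.1
    refine ⟨z - v, ⟨sub_mem hz.1 (C.F_le (by omega) n hv1), ?_⟩, ?_⟩
    · change C.d n (z - v) ∈ C.F _ _
      rw [map_sub, ← huv, add_sub_cancel_right]
      exact C.F_le (by push_cast; omega) _ hu.1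
    · rw [← sub_add]
      exact add_mem hxz hv1

theorem DegeneratesAt.exists_closed (hC : C.DegeneratesAt 1) {n : ℕ} {m : ℤ}
    (hm : C.F m (n + 1) = ⊥) {x : C.K n} (hx : x ∈ C.Z 1 0 n) :
    ∃ z, C.d n z = 0 ∧ x - z ∈ C.F 1 n := by
  obtain ⟨z, hz, hxz⟩ := hC.exists_mem_Z hx m.toNat
  refine ⟨z, ?_, hxz⟩
  have h := C.F_le (show m ≤ 0 + (m.toNat + 1 : ℕ) by omega) (n + 1) hz.2
  rwa [hm] at h

/-- The denominator of the pages in the column `p = 0`: the boundaries that arrive at this column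
come from `F^p` with `p ≤ 0`, that is, from the whole complex, so they do not depend on the page. -/
theorem mem_W_zero_iff (htop : ∀ p ≤ 0, ∀ n, C.F p n = ⊤) {r : ℤ} (hr : 1 ≤ r) {n : ℕ}
    {x : C.K n} :
    x ∈ C.W r 0 n ↔ ∃ y ∈ C.F 1 n, C.d n y ∈ C.F r (n + 1) ∧ x - y ∈ C.dZ 0 0 n := by
  have hZ : ∀ y, y ∈ C.Z (r - 1) (0 + 1) n ↔ y ∈ C.F 1 n ∧ C.d n y ∈ C.F r (n + 1) := by
    intro y
    rw [Z, zero_add, add_sub_cancel]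
    rfl
  have hdZ : C.dZ (r - 1) (0 - r + 1) n = C.dZ 0 0 n := by
    cases n with
    | zero => rfl
    | succ n =>
      simp only [dZ, Z]
      rw [htop (0 - r + 1) (by omega), htop (0 - r + 1 + (r - 1)) (by omega), htop 0 le_rfl,
        htop (0 + 0) (by omega)]
  rw [W, hdZ, Submodule.mem_sup]
  constructor
  · rintro ⟨y, hy, z, hz, rfl⟩
    exact ⟨y, ((hZ y).1 hy).1, ((hZ y).1 hy).2, by rwa [add_sub_cancel_left]⟩
  · rintro ⟨y, hy, hdy, hxy⟩
    exact ⟨y, (hZ y).2 ⟨hy, hdy⟩, x - y, hxy, by abel⟩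

theorem dPage_zero_eq_zero {n : ℕ}
    (hcl : ∀ x ∈ C.Z 1 0 n, ∃ z, C.d n z = 0 ∧ x - z ∈ C.F 1 n) {r : ℤ} (hr : 1 ≤ r) :
    C.dPage r 0 n = 0 := by
  ext c
  obtain ⟨⟨x, hx⟩, rfl⟩ := Subquotient.mk_surjective _ _ c
  obtain ⟨z, hz, hxz⟩ := hcl x ⟨hx.1, C.F_le (by omega) _ hx.2⟩
  -- The correction `x - z` lies in `Z_{r-1}^{1}` and has the same differential as `x`.
  have hd : C.d n (x - z) = C.d n x := by rw [map_sub, hz, sub_zero]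
  refine Subquotient.mk_eq_zero_iff.2 (Submodule.mem_sup_right ⟨x - z, ⟨?_, ?_⟩, hd⟩)
  · exact C.F_le (by omega) n hxz
  · change C.d n (x - z) ∈ C.F _ _
    rw [hd]
    exact C.F_le (by omega) _ hx.2

theorem exists_linearEquiv_E_one (htop : ∀ p ≤ 0, ∀ n, C.F p n = ⊤) {n : ℕ}
    (hcl : ∀ x ∈ C.Z 1 0 n, ∃ z, C.d n z = 0 ∧ x - z ∈ C.F 1 n) {r : ℤ} (hr : 1 ≤ r) :
    ∃ e : C.E r 0 n ≃ₗ[ℂ] C.E 1 0 n, ∀ x : C.Z r 0 n, ∃ hx : x.1 ∈ C.Z 1 0 n,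
      e (Subquotient.mk _ _ x) = Subquotient.mk _ _ ⟨x.1, hx⟩ := by
  have hZ : ∀ x ∈ C.Z r 0 n, x ∈ C.Z 1 0 n := fun x hx => ⟨hx.1, C.F_le (by omega) _ hx.2⟩
  suffices hW : (∀ x ∈ C.Z r 0 n, LinearMap.id (R := ℂ) x ∈ C.W 1 0 n ↔ x ∈ C.W r 0 n) ∧
      ∀ y ∈ C.Z 1 0 n, ∃ x ∈ C.Z r 0 n, LinearMap.id (R := ℂ) x - y ∈ C.W 1 0 n by
    obtain ⟨e, he⟩ := Subquotient.exists_linearEquiv LinearMap.id hZ hW.1 hW.2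
    exact ⟨e, fun x => ⟨hZ x x.2, he x⟩⟩
  refine ⟨fun x hx => ?_, fun y hy => ?_⟩
  · rw [LinearMap.id_apply, mem_W_zero_iff htop le_rfl, mem_W_zero_iff htop hr]
    constructor
    · rintro ⟨y, hy, -, hxy⟩
      have hd : C.d n y = C.d n x := by
        have := C.d_eq_zero_of_mem_dZ hxy
        rw [map_sub, sub_eq_zero] at this
        exact this.symm
      refine ⟨y, hy, ?_, hxy⟩
      rw [hd]
      exact C.F_le (by omega) _ hx.2
    · rintro ⟨y, hy, hdy, hxy⟩
      exact ⟨y, hy, C.F_le hr _ hdy, hxy⟩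
  · obtain ⟨z, hz, hyz⟩ := hcl y hy
    refine ⟨z, ⟨?_, ?_⟩, ?_⟩
    · rw [htop 0 le_rfl]; trivial
    · change C.d n z ∈ C.F _ _
      rw [hz]; exact zero_mem _
    · rw [mem_W_zero_iff htop le_rfl]
      refine ⟨z - y, ?_, ?_, by simp⟩
      · rw [← neg_sub]; exact neg_mem hyz
      · rw [map_sub, hz, zero_sub]
        exact neg_mem (C.F_le (by omega) _ hy.2)

end FilteredComplex

/-! ### Pullback along morphisms of Lie algebroids -/

namespace AlmostLieAlgebroid

variable {A M M' : Type*} [CommRing A] [Algebra ℂ A] [AddCommGroup M] [Module A M]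
    [Module ℂ M] [AddCommGroup M'] [Module A M'] [Module ℂ M'] {n : ℕ}

/-- Pullback along a morphism of Lie algebroids is a chain map. -/
theorem diff_compLinearMap {S : AlmostLieAlgebroid A M} {S' : AlmostLieAlgebroid A M'}
    (φ : M →ₗ[A] M') (hanchor : ∀ v, S'.anchor (φ v) = S.anchor v)
    (hbracket : ∀ v w, S'.bracket (φ v) (φ w) = φ (S.bracket v w))
    (P : M' [⋀^Fin n]→ₗ[A] A) :
    S.diff n (P.compLinearMap φ) = (S'.diff n P).compLinearMap φ := by
  ext w
  have hupd : ∀ (u : Fin n → M) (j : Fin n) (v : M),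
      (fun i => φ (update u j v i)) = update (fun i => φ (u i)) j (φ v) :=
    fun u j v => Function.comp_update φ u j v
  have hrem : ∀ i : Fin (n + 1),
      (fun j => φ (i.removeNth w j)) = i.removeNth fun k => φ (w k) := fun i => rfl
  simp only [diff_apply, diffFun, AlternatingMap.compLinearMap_apply, hupd, hrem, hanchor,
    hbracket]

/-- A form in `F^p` vanishes if `p` exceeds its degree. -/
theorem filtration_eq_bot {M₀ M₁ : Submodule A M} (hM : Codisjoint M₀ M₁) {p : ℤ} (h : n < p) :
    filtration M₀ M₁ p n = ⊥ := by
  refine eq_bot_iff.2 fun P hP => (Submodule.mem_bot ℂ).2 ?_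
  ext w
  have hw : ∀ i, ∃ x ∈ M₀, ∃ y ∈ M₁, x + y = w i := fun i => by
    rw [← Submodule.mem_sup, hM.eq_top]; exact Submodule.mem_top
  choose x hx y hy hxy using hw
  obtain rfl : y + x = w := funext fun i => (add_comm _ _).trans (hxy i)
  rw [← AlternatingMap.coe_multilinearMap, MultilinearMap.map_add_univ]
  refine Finset.sum_eq_zero fun s _ => hP s _ ?_ ?_ ?_
  · have := s.card_le_univ
    rw [Fintype.card_fin] at this
    omega
  · intro i hi; simpa [hi] using hy i
  · intro i hi; simpa [hi] using hx i

theorem mem_filtration_one {M₀ M₁ : Submodule A M} {P : M [⋀^Fin n]→ₗ[A] A} :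
    P ∈ filtration M₀ M₁ 1 n ↔ ∀ w : Fin n → M, (∀ i, w i ∈ M₀) → P w = 0 := by
  constructor
  · intro hP w hw
    exact hP ∅ w (by simp) (by simp) fun i _ => hw i
  · intro hP s w hs _ h0
    obtain rfl : s = ∅ := Finset.card_eq_zero.1 (by omega)
    exact hP w fun i => h0 i (by simp)

end AlmostLieAlgebroid

/-! ### The `(0,q)`-component of forms and of polyvector fields -/

namespace TangentSplitting

open AlmostLieAlgebroid

variable {A : Type*} [CommRing A] [Algebra ℂ A] {J : TangentSplitting A} {q : ℕ}
  {Λ : J.Bivector} {h : Λ.IsHolomorphicPoisson}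

theorem frolicherComplex_mem_F_one_iff {P : J.frolicherComplex.K q} :
    P ∈ J.frolicherComplex.F 1 q ↔ AlternatingMap.compLinearMap P J.T01.subtype = 0 := by
  refine mem_filtration_one.trans ⟨fun hP => ?_, fun hP w hw => ?_⟩
  · ext w
    exact hP _ fun i => (w i).2
  · exact DFunLike.congr_fun hP fun i => ⟨w i, hw i⟩

theorem poissonComplex_mem_F_one_iff {P : (poissonComplex Λ h).K q} :
    P ∈ (poissonComplex Λ h).F 1 q ↔ restrict P = 0 := by
  refine mem_filtration_one.trans ⟨fun hP => ?_, fun hP w hw => ?_⟩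
  · ext w
    exact hP _ fun i => ⟨trivial, rfl⟩
  · have hw' : w = fun i => LinearMap.inl A J.T01 J.Form10 (w i).1 :=
      funext fun i => Prod.ext rfl (hw i).2
    rw [hw']
    exact DFunLike.congr_fun hP fun i => (w i).1

theorem poissonComplex_F_of_nonpos (p : ℤ) (hp : p ≤ 0) (n : ℕ) :
    (poissonComplex Λ h).F p n = ⊤ :=
  filtration_of_nonpos _ _ hp n

theorem poissonComplex_d (n : ℕ) :
    (poissonComplex Λ h).d n = (J.LbarAlgebroid + Λ.algebroid).diff n :=
  (add_diff _ _ n).symm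

variable (J) in
theorem compLinearMap_T01_frolicher_d (P : Derivation ℂ A A [⋀^Fin q]→ₗ[A] A) :
    (J.frolicherComplex.d q P).compLinearMap J.T01.subtype =
      J.T01Algebroid.diff q (P.compLinearMap J.T01.subtype) :=
  (diff_compLinearMap (S := J.T01Algebroid) (S' := tangentAlgebroid A) J.T01.subtype
    (fun _ => rfl) (fun _ _ => rfl) P).symm

theorem restrict_poissonComplex_d (P : (poissonComplex Λ h).K q) :
    restrict ((poissonComplex Λ h).d q P) = J.T01Algebroid.diff q (restrict P) := by
  rw [poissonComplex_d]
  refine (diff_compLinearMap (S := J.T01Algebroid) (LinearMap.inl A J.T01 J.Form10)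
    (fun v => ?_) (fun v w => ?_) P).symm
  · simp [add_anchor, LbarAlgebroid, Bivector.algebroid, T01Algebroid]
  · rw [Λ.algebroid_add_bracket]
    simp

theorem mem_poissonComplex_Z_one_iff {P : (poissonComplex Λ h).K q} :
    P ∈ (poissonComplex Λ h).Z 1 0 q ↔ restrict P ∈ J.dolbeaultCocycles q := by
  have e : (poissonComplex Λ h).d q P ∈ (poissonComplex Λ h).F (0 + 1) (q + 1) ↔
      restrict P ∈ J.dolbeaultCocycles q := by
    rw [zero_add, poissonComplex_mem_F_one_iff, restrict_poissonComplex_d]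
    exact LinearMap.mem_ker.symm
  refine ⟨fun hP => e.1 hP.2, fun hP => ⟨?_, e.2 hP⟩⟩
  rw [poissonComplex_F_of_nonpos 0 le_rfl]
  trivial

/-- The pullback of forms along the anchor `X̄ + ω ↦ X̄ + Λω` is a chain map to the Poisson
complex. -/
theorem poissonComplex_d_compLinearMap_anchor (P : Derivation ℂ A A [⋀^Fin q]→ₗ[A] A) :
    (poissonComplex Λ h).d q (P.compLinearMap (J.LbarAlgebroid + Λ.algebroid).anchor) =
      (J.frolicherComplex.d q P).compLinearMap (J.LbarAlgebroid + Λ.algebroid).anchor := by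
  rw [poissonComplex_d]
  exact diff_compLinearMap (S := J.LbarAlgebroid + Λ.algebroid) (S' := tangentAlgebroid A)
    (J.LbarAlgebroid + Λ.algebroid).anchor (fun _ => rfl)
    (fun v w => (h.isLieAlgebroid.anchor_bracket v w).symm) P

theorem restrict_compLinearMap_anchor (P : Derivation ℂ A A [⋀^Fin q]→ₗ[A] A) :
    restrict (P.compLinearMap (J.LbarAlgebroid + Λ.algebroid).anchor) =
      P.compLinearMap J.T01.subtype := by
  ext w
  simp [restrict, add_anchor, LbarAlgebroid, Bivector.algebroid]

theorem restrict_compLinearMap_fst (α : J.T01 [⋀^Fin q]→ₗ[A] A) :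
    restrict (α.compLinearMap (LinearMap.fst A J.T01 J.Form10)) = α := by
  ext w
  simp [restrict]

/-! ### Closed extensions and the comparison with Dolbeault cohomology -/

/-- If the Frölicher spectral sequence degenerates at `E₁`, then every `∂̄`-closed `(0,q)`-form is
the component of type `(0,q)` of a `d`-closed form. -/
theorem exists_closed_form (hF : J.frolicherComplex.DegeneratesAt 1)
    {α : J.T01 [⋀^Fin q]→ₗ[A] A} (hα : α ∈ J.dolbeaultCocycles q) :
    ∃ P : Derivation ℂ A A [⋀^Fin q]→ₗ[A] A,
      J.frolicherComplex.d q P = 0 ∧ P.compLinearMap J.T01.subtype = α := by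
  have hres : (α.compLinearMap J.pr01).compLinearMap J.T01.subtype = α := by
    ext w
    simp
  let α' : J.frolicherComplex.K q := α.compLinearMap J.pr01
  have hZ : α' ∈ J.frolicherComplex.Z 1 0 q := by
    refine ⟨(filtration_of_nonpos J.T01 J.T10 le_rfl q).ge Submodule.mem_top, ?_⟩
    change J.frolicherComplex.d q α' ∈ J.frolicherComplex.F (0 + 1) (q + 1)
    rw [zero_add, frolicherComplex_mem_F_one_iff]
    refine (J.compLinearMap_T01_frolicher_d _).trans ?_
    rw [hres]
    exact hα
  have hbot : J.frolicherComplex.F (q + 2) (q + 1) = ⊥ :=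
    filtration_eq_bot J.isCompl.symm.codisjoint (by push_cast; omega)
  obtain ⟨P, hP, hαP⟩ := hF.exists_closed hbot hZ
  refine ⟨P, hP, (sub_eq_zero.1 ?_).symm⟩
  refine Eq.trans ?_ (frolicherComplex_mem_F_one_iff.1 hαP)
  conv_lhs => rw [← hres]
  rfl

theorem poissonComplex_exists_closed (hF : J.frolicherComplex.DegeneratesAt 1)
    (P : (poissonComplex Λ h).K q) (hP : P ∈ (poissonComplex Λ h).Z 1 0 q) :
    ∃ Q, (poissonComplex Λ h).d q Q = 0 ∧ P - Q ∈ (poissonComplex Λ h).F 1 q := by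
  obtain ⟨R, hR, hRP⟩ := exists_closed_form hF (mem_poissonComplex_Z_one_iff.1 hP)
  refine ⟨R.compLinearMap (J.LbarAlgebroid + Λ.algebroid).anchor, ?_, ?_⟩
  · rw [poissonComplex_d_compLinearMap_anchor, hR]
    rfl
  · refine poissonComplex_mem_F_one_iff.2 ?_
    change restrict P - restrict (R.compLinearMap (J.LbarAlgebroid + Λ.algebroid).anchor) = 0
    rw [restrict_compLinearMap_anchor, hRP, sub_self]

variable (J) in
/-- The map `restrict` as a linear map. -/
def restrictₗ (q : ℕ) : (J.Lbar [⋀^Fin q]→ₗ[A] A) →ₗ[ℂ] (J.T01 [⋀^Fin q]→ₗ[A] A) where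
  toFun := restrict
  map_add' _ _ := rfl
  map_smul' _ _ := rfl

theorem restrict_mem_coboundaries_iff {P : (poissonComplex Λ h).K q} :
    restrict P ∈ J.T01Algebroid.coboundaries q ↔ P ∈ (poissonComplex Λ h).W 1 0 q := by
  rw [FilteredComplex.mem_W_zero_iff poissonComplex_F_of_nonpos le_rfl]
  constructor
  · intro hP
    have key : ∃ Q : (poissonComplex Λ h).K q, Q ∈ (poissonComplex Λ h).dZ 0 0 q ∧
        restrict Q = restrict P := by
      cases q with
      | zero => exact ⟨0, rfl, ((Submodule.mem_bot ℂ).1 hP).symm⟩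
      | succ q =>
        obtain ⟨β, hβ⟩ := hP
        refine ⟨_, ⟨β.compLinearMap (LinearMap.fst A J.T01 J.Form10), ⟨?_, ?_⟩, rfl⟩, ?_⟩
        · rw [poissonComplex_F_of_nonpos 0 le_rfl]; trivial
        · change _ ∈ (poissonComplex Λ h).F (0 + 0) _
          rw [poissonComplex_F_of_nonpos (0 + 0) le_rfl]; trivial
        · refine (restrict_poissonComplex_d _).trans ?_
          rw [restrict_compLinearMap_fst, hβ]
    obtain ⟨Q, hQ, hQP⟩ := key
    have hF1 : P - Q ∈ (poissonComplex Λ h).F 1 q :=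
      poissonComplex_mem_F_one_iff.2 (sub_eq_zero.2 hQP.symm)
    refine ⟨P - Q, hF1, (poissonComplex Λ h).d_mem_F 1 q _ hF1, ?_⟩
    rwa [sub_sub_cancel]
  · rintro ⟨Q, hQ, -, hPQ⟩
    have hres : restrict P = restrict (P - Q) := by
      rw [poissonComplex_mem_F_one_iff] at hQ
      change _ = restrict P - restrict Q
      rw [hQ, sub_zero]
    rw [hres]
    cases q with
    | zero => rw [(Submodule.mem_bot ℂ).1 hPQ]; exact zero_mem _
    | succ q =>
      obtain ⟨R, -, hR⟩ := hPQ
      rw [← hR, restrict_poissonComplex_d]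
      exact ⟨_, rfl⟩

variable (q Λ h) in
/-- The first page of the Poisson spectral sequence, in the column `p = 0`. -/
theorem exists_linearEquiv_dolbeaultCohomology :
    ∃ e : (poissonComplex Λ h).E 1 0 q ≃ₗ[ℂ] J.DolbeaultCohomology q,
      ∀ x : (poissonComplex Λ h).Z 1 0 q, ∃ hx : restrict x.1 ∈ J.dolbeaultCocycles q,
        e (Subquotient.mk _ _ x) = J.dolbeaultClass q ⟨restrict x.1, hx⟩ := by
  have hsurj : ∀ α ∈ J.dolbeaultCocycles q, ∃ P ∈ (poissonComplex Λ h).Z 1 0 q,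
      J.restrictₗ q P - α ∈ J.T01Algebroid.coboundaries q := by
    intro α hα
    have hα' := restrict_compLinearMap_fst α
    refine ⟨α.compLinearMap (LinearMap.fst A J.T01 J.Form10),
      mem_poissonComplex_Z_one_iff.2 (by rwa [hα']), ?_⟩
    change restrict _ - α ∈ _
    rw [hα', sub_self]
    exact zero_mem _
  obtain ⟨e, he⟩ := Subquotient.exists_linearEquiv (Z := (poissonComplex Λ h).Z 1 0 q)
    (B := (poissonComplex Λ h).W 1 0 q) (J.restrictₗ q)
    (fun P hP => mem_poissonComplex_Z_one_iff.1 hP)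
    (fun P _ => restrict_mem_coboundaries_iff) hsurj
  exact ⟨e, fun x => ⟨mem_poissonComplex_Z_one_iff.1 x.2, he x⟩⟩

end TangentSplitting

theorem lemma11 {E : Type*} [NormedAddCommGroup E] [NormedSpace ℂ E] [FiniteDimensional ℂ E]
    {X : Type*} [TopologicalSpace X] [T2Space X] [SecondCountableTopology X] [ChartedSpace E X]
    [IsManifold 𝓘(ℂ, E) ω X]
    (Λ : (tangentSplitting E X).Bivector) (hΛ : Λ.IsHolomorphicPoisson)
    (hF : (tangentSplitting E X).frolicherComplex.DegeneratesAt 1) (q : ℕ) :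
    (∃ e : (TangentSplitting.poissonComplex Λ hΛ).E 1 0 q ≃ₗ[ℂ]
        (tangentSplitting E X).DolbeaultCohomology q,
      ∀ x : (TangentSplitting.poissonComplex Λ hΛ).Z 1 0 q,
        ∃ hx : TangentSplitting.restrict x.1 ∈ (tangentSplitting E X).dolbeaultCocycles q,
          e (Subquotient.mk _ _ x) =
            (tangentSplitting E X).dolbeaultClass q ⟨TangentSplitting.restrict x.1, hx⟩) ∧
    ∀ n : ℕ, 2 ≤ n →
      (∃ e : (TangentSplitting.poissonComplex Λ hΛ).E n 0 q ≃ₗ[ℂ]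
          (TangentSplitting.poissonComplex Λ hΛ).E 1 0 q,
        ∀ x : (TangentSplitting.poissonComplex Λ hΛ).Z n 0 q,
          ∃ hx : x.1 ∈ (TangentSplitting.poissonComplex Λ hΛ).Z 1 0 q,
            e (Subquotient.mk _ _ x) = Subquotient.mk _ _ ⟨x.1, hx⟩) ∧
      (TangentSplitting.poissonComplex Λ hΛ).dPage n 0 q = 0 := by
  have hcl := TangentSplitting.poissonComplex_exists_closed (h := hΛ) (q := q) hF
  refine ⟨TangentSplitting.exists_linearEquiv_dolbeaultCohomology q Λ hΛ, fun n hn => ⟨?_, ?_⟩⟩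
  · exact FilteredComplex.exists_linearEquiv_E_one TangentSplitting.poissonComplex_F_of_nonpos hcl
      (by omega)
  · exact FilteredComplex.dPage_zero_eq_zero hcl (by omega)
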